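/- Let $X$ be a compact Riemann surface, $\Gamma$ a finite group acting on $X$ on the right by holomorphic automorphisms, $G$ a connected semisimple complex Lie group with centre $Z$, $\theta:\Gamma\to\mathrm{Aut}(G)$, $\gamma\mapsto\theta_\gamma$, a homomorphism to the group of holomorphic automorphisms of $G$, and $c:\Gamma\times\Gamma\to Z$ a $2$-cocycle, i.e. $c(\gamma,1)=c(1,\gamma)=1$ and $\theta_{\gamma_0}(c(\gamma_1,\gamma_2))\,c(\gamma_0,\gamma_1\gamma_2)=c(\gamma_0,\gamma_1)\,c(\gamma_0\gamma_1,\gamma_2)$. Let $G\times_{(\theta,c)}\Gamma$ be the set $G\times\Gamma$ with the group law $(g,\gamma)(g',\gamma')=(g\,\theta_\gamma(g')\,c(\gamma,\gamma'),\gamma\gamma')$, and fix an embedding of complex Lie groups $\iota:G\times_{(\theta,c)}\Gamma\hookrightarrow \mathrm{SL}(n,\mathbb C)$. Identify $G$ with the subgroup $\iota(G\times\{1\})$ and write $(1,\gamma)$ for $\iota(1,\gamma)$. Let $\mathcal A$ be the category of $(\theta,c)$-twisted $\Gamma$-equivariant $G$-bundles over $X$. Its objects are pairs $(P,\bullet)$,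 where $P\to X$ is a holomorphic principal $G$-bundle and $P\times\Gamma\to P$, $(q,\gamma)\mapsto q\bullet\gamma$, is a holomorphic map covering the action of $\Gamma$ on $X$ such that, for all $q\in P$, $g\in G$ and $\gamma,\gamma'\in\Gamma$, $$q\bullet 1=q,\qquad (qg)\bullet\gamma=(q\bullet\gamma)\,\theta_\gamma^{-1}(g),\qquad (q\bullet\gamma)\bullet\gamma'=(q\,c(\gamma,\gamma'))\bullet(\gamma\gamma').$$ Its morphisms are the $\Gamma$-equivariant isomorphisms of holomorphic $G$-bundles over $X$. Let $\mathcal B$ be the category of $\Gamma$-pseudo-equivariant $G$-bundles of rank $n$ over $X$. Its objects are triples $(E,h,f)$, where $E$ is a holomorphic vector bundle of rank $n$ over $X$, $h$ is a reduction of the structure group of its bundle of frames to $G$, i.e. a holomorphic section over $X$ of $\mathrm{Iso}(\mathcal O_X^{\oplus n},E)/G$, and $f=\{f_\gamma:E\xrightarrow{\sim}\gamma^*E\}_{\gamma\in\Gamma}$ is a family of isomorphisms of holomorphic vector bundles such that, for all $\gamma,\gamma'\in\Gamma$, $$f_1=\mathrm{id},\qquad (\gamma^*f_{\gamma'})\circ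 f_\gamma=f_{\gamma\gamma'},\qquad f_\gamma(h)=(\gamma^*h)(1,\gamma)^{-1}.$$ Its morphisms $(E,h,f)\to(E',h',f')$ are the isomorphisms of holomorphic vector bundles $\phi:E\xrightarrow{\sim}E'$ with $\phi(h)=h'$ and $f'_\gamma\circ\phi=(\gamma^*\phi)\circ f_\gamma$ for every $\gamma\in\Gamma$. Then the categories $\mathcal A$ and $\mathcal B$ are equivalent. -/

import Mathlib

open scoped Manifold ContDiff Bundle RightActions
open CategoryTheory

universe u v w z

/-- A complex Lie group is semisimple if its Lie algebra (the tangent space at `1` with the bracket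
of left-invariant vector fields) is semisimple. -/
def IsSemisimpleComplexLieGroup (V : Type v) [NormedAddCommGroup V] [NormedSpace ℂ V]
    [FiniteDimensional ℂ V] (G : Type w) [Group G] [TopologicalSpace G] [ChartedSpace V G]
    [LieGroup 𝓘(ℂ, V) ω G] : Prop :=
  haveI : CompleteSpace V := FiniteDimensional.complete ℂ V
  haveI : LieGroup 𝓘(ℂ, V) (minSmoothness ℂ 3) G := LieGroup.of_le (n := ω) le_top
  LieAlgebra.IsSemisimple ℂ (GroupLieAlgebra 𝓘(ℂ, V) G)

/-! ### Cocycles and the twisted product -/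

/-- Normalised 2-cocycles of `Γ` with values in the centre of `G`, where `Γ` acts through `θ`. -/
structure TwoCocycle {Γ : Type z} {G : Type w} [Group Γ] [Group G] (θ : Γ →* MulAut G) where
  /-- the underlying function of two variables -/
  toFun : Γ → Γ → G
  mem_center : ∀ a b, toFun a b ∈ Subgroup.center G
  one_right : ∀ a, toFun a 1 = 1
  one_left : ∀ a, toFun 1 a = 1
  cocycle : ∀ a b d, θ a (toFun b d) * toFun a (b * d) = toFun a b * toFun (a * b) d

/-- The set `G × Γ` underlying the twisted product of `G` and `Γ` along `(θ, c)`. -/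
@[ext]
structure TwistedProduct {Γ : Type z} {G : Type w} [Group Γ] [Group G] (θ : Γ →* MulAut G)
    (c : TwoCocycle θ) where
  /-- the component in `G` -/
  left : G
  /-- the component in `Γ` -/
  right : Γ

namespace TwistedProduct

variable {Γ : Type z} {G : Type w} [Group Γ] [Group G] {θ : Γ →* MulAut G} {c : TwoCocycle θ}

instance : Mul (TwistedProduct θ c) :=
  ⟨fun a b => ⟨a.left * θ a.right b.left * c.toFun a.right b.right, a.right * b.right⟩⟩

instance : One (TwistedProduct θ c) := ⟨⟨1, 1⟩⟩

instance : Inv (TwistedProduct θ c) :=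
  ⟨fun a => ⟨(c.toFun a.right⁻¹ a.right)⁻¹ * (θ a.right⁻¹ a.left)⁻¹, a.right⁻¹⟩⟩

theorem mul_def (a b : TwistedProduct θ c) :
    a * b = ⟨a.left * θ a.right b.left * c.toFun a.right b.right, a.right * b.right⟩ := rfl

theorem one_def : (1 : TwistedProduct θ c) = ⟨1, 1⟩ := rfl

theorem inv_def (a : TwistedProduct θ c) :
    a⁻¹ = ⟨(c.toFun a.right⁻¹ a.right)⁻¹ * (θ a.right⁻¹ a.left)⁻¹, a.right⁻¹⟩ := rfl

/-- The group law `(g, γ) (g', γ') = (g θ_γ(g') c(γ, γ'), γ γ')`. -/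
instance : Group (TwistedProduct θ c) :=
  Group.ofLeftAxioms
    (by
      intro a b d
      have hc : ∀ x y (g : G), c.toFun x y * g = g * c.toFun x y := fun x y g =>
        ((Subgroup.mem_center_iff.mp (c.mem_center x y)) g).symm
      ext
      · simp only [mul_def, map_mul, MulAut.mul_apply]
        have h := c.cocycle a.right b.right d.right
        calc a.left * θ a.right b.left * c.toFun a.right b.right *
              θ a.right (θ b.right d.left) * c.toFun (a.right * b.right) d.right
            = a.left * θ a.right b.left * (θ a.right (θ b.right d.left) *
              (c.toFun a.right b.right * c.toFun (a.right * b.right) d.right)) := by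
              rw [mul_assoc (a.left * θ a.right b.left) (c.toFun a.right b.right), hc]
              simp only [mul_assoc]
          _ = _ := by
              rw [← h]; simp only [mul_assoc]
      · simp only [mul_def, mul_assoc])
    (by
      intro a
      ext <;> simp [mul_def, one_def, c.one_left])
    (by
      intro a
      ext
      · simp [mul_def, inv_def, one_def]
      · simp [mul_def, inv_def, one_def])

/-- The inclusion `g ↦ (g, 1)` of `G` in the twisted product. -/
def inl (θ : Γ →* MulAut G) (c : TwoCocycle θ) : G →* TwistedProduct θ c where
  toFun g := ⟨g, 1⟩
  map_one' := rfl
  map_mul' g g' := by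
    ext <;> simp [mul_def, c.one_left]

/-- The element `(1, γ)` of the twisted product. -/
def lift (θ : Γ →* MulAut G) (c : TwoCocycle θ) (γ : Γ) : TwistedProduct θ c := ⟨1, γ⟩

end TwistedProduct

/-- A homomorphism from the twisted product to `SL(n, ℂ)` is an embedding (of complex Lie groups) if
it is injective and restricts to a holomorphic embedding, i.e. a holomorphic immersion that is a
topological embedding, on the identity component `G`. Here `SL(n, ℂ)` is regarded as a subset of the
space of `n × n` matrices; the twisted product is the disjoint union of finitely many cosets of `G`,
on which `ι` is a translate of its restriction to `G`. -/
structure IsTwistedEmbedding {V : Type v} [NormedAddCommGroup V] [NormedSpace ℂ V]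
    {Γ : Type z} {G : Type w} [Group Γ] [Group G] [TopologicalSpace G] [ChartedSpace V G]
    {θ : Γ →* MulAut G} {c : TwoCocycle θ} {n : ℕ}
    (ι : TwistedProduct θ c →* Matrix.SpecialLinearGroup (Fin n) ℂ) : Prop where
  injective : Function.Injective ι
  isSmoothEmbedding : Manifold.IsSmoothEmbedding 𝓘(ℂ, V) 𝓘(ℂ, Fin n → Fin n → ℂ) ω
    (fun (g : G) (i j : Fin n) => (ι (TwistedProduct.inl θ c g)).1 i j)

/-! ### Twisted equivariant principal bundles -/

/-- A holomorphic principal `G`-bundle over the Riemann surface `X`, with `G` acting on the right. -/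
structure HolPrincipalBundle (V : Type v) [NormedAddCommGroup V] [NormedSpace ℂ V]
    (G : Type w) [Group G] [TopologicalSpace G] [ChartedSpace V G]
    (X : Type u) [TopologicalSpace X] [ChartedSpace ℂ X] where
  /-- the total space, a complex manifold -/
  P : Type u
  [topP : TopologicalSpace P]
  [chartedP : ChartedSpace (ModelProd ℂ V) P]
  [manifoldP : IsManifold (𝓘(ℂ, ℂ).prod 𝓘(ℂ, V)) ω P]
  /-- the right action of `G` -/
  [actionP : MulAction Gᵐᵒᵖ P]
  /-- the bundle projection -/
  proj : P → X
  contMDiff_proj : ContMDiff (𝓘(ℂ, ℂ).prod 𝓘(ℂ, V)) 𝓘(ℂ, ℂ) ω proj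
  proj_smul : ∀ (q : P) (g : G), proj (q <• g) = proj q
  contMDiff_smul : ContMDiff ((𝓘(ℂ, ℂ).prod 𝓘(ℂ, V)).prod 𝓘(ℂ, V)) (𝓘(ℂ, ℂ).prod 𝓘(ℂ, V)) ω
    (fun q : P × G => q.1 <• q.2)
  /-- local triviality: over a neighbourhood `U` of any point there is a `G`-equivariant
  biholomorphism from the preimage of `U` to `U × G` over `U` -/
  exists_trivialization : ∀ x : X, ∃ e : Bundle.Trivialization G proj, x ∈ e.baseSet ∧
    ContMDiffOn (𝓘(ℂ, ℂ).prod 𝓘(ℂ, V)) (𝓘(ℂ, ℂ).prod 𝓘(ℂ, V)) ω e e.source ∧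
    ContMDiffOn (𝓘(ℂ, ℂ).prod 𝓘(ℂ, V)) (𝓘(ℂ, ℂ).prod 𝓘(ℂ, V)) ω
      e.toOpenPartialHomeomorph.symm e.target ∧
    ∀ q ∈ e.source, ∀ g : G, e (q <• g) = ((e q).1, (e q).2 * g)

attribute [instance] HolPrincipalBundle.topP HolPrincipalBundle.chartedP
  HolPrincipalBundle.manifoldP HolPrincipalBundle.actionP

/-- A `(θ, c)`-twisted `Γ`-equivariant `G`-bundle over `X`. -/
structure TwistedEquivariantBundle (V : Type v) [NormedAddCommGroup V] [NormedSpace ℂ V]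
    {Γ : Type z} {G : Type w} [Group Γ] [Group G] [TopologicalSpace G] [ChartedSpace V G]
    (X : Type u) [TopologicalSpace X] [ChartedSpace ℂ X] [MulAction Γᵐᵒᵖ X]
    (θ : Γ →* MulAut G) (c : TwoCocycle θ) extends HolPrincipalBundle V G X where
  /-- the twisted action: `act q γ` is `q • γ` -/
  act : P → Γ → P
  contMDiff_act : ∀ γ : Γ, ContMDiff (𝓘(ℂ, ℂ).prod 𝓘(ℂ, V)) (𝓘(ℂ, ℂ).prod 𝓘(ℂ, V)) ω
    (fun q => act q γ)
  act_one : ∀ q, act q 1 = q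
  act_smul : ∀ q (g : G) γ, act (q <• g) γ = act q γ <• (θ γ)⁻¹ g
  act_act : ∀ q γ γ', act (act q γ) γ' = act (q <• c.toFun γ γ') (γ * γ')
  proj_act : ∀ q γ, proj (act q γ) = proj q <• γ

namespace TwistedEquivariantBundle

variable {V : Type v} [NormedAddCommGroup V] [NormedSpace ℂ V]
  {Γ : Type z} {G : Type w} [Group Γ] [Group G] [TopologicalSpace G] [ChartedSpace V G]
  {X : Type u} [TopologicalSpace X] [ChartedSpace ℂ X] [MulAction Γᵐᵒᵖ X]
  {θ : Γ →* MulAut G} {c : TwoCocycle θ}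

/-- Isomorphisms of twisted equivariant bundles: `Γ`-equivariant isomorphisms of holomorphic
`G`-bundles over `X`. -/
@[ext]
structure Iso (A B : TwistedEquivariantBundle V X θ c) where
  /-- the underlying biholomorphism of total spaces -/
  toDiffeo : Diffeomorph (𝓘(ℂ, ℂ).prod 𝓘(ℂ, V)) (𝓘(ℂ, ℂ).prod 𝓘(ℂ, V)) A.P B.P ω
  proj_map : ∀ q, B.proj (toDiffeo q) = A.proj q
  map_smul : ∀ q (g : G), toDiffeo (q <• g) = toDiffeo q <• g
  map_act : ∀ q γ, toDiffeo (A.act q γ) = B.act (toDiffeo q) γ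

/-- The category of twisted equivariant bundles, whose morphisms are the isomorphisms. -/
noncomputable instance : Category (TwistedEquivariantBundle V X θ c) where
  Hom A B := Iso A B
  id A := ⟨Diffeomorph.refl _ _ _, fun _ => rfl, fun _ _ => rfl, fun _ _ => rfl⟩
  comp φ ψ :=
    { toDiffeo := φ.toDiffeo.trans ψ.toDiffeo
      proj_map := fun q => by simp [ψ.proj_map, φ.proj_map]
      map_smul := fun q g => by simp [ψ.map_smul, φ.map_smul]
      map_act := fun q γ => by simp [ψ.map_act, φ.map_act] }
  id_comp φ := by ext; rfl
  comp_id φ := by ext; rfl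
  assoc φ ψ χ := by ext; rfl

end TwistedEquivariantBundle

/-! ### Pseudo-equivariant bundles -/

/-- A holomorphic vector bundle of rank `n` over the Riemann surface `X`. -/
structure HolVectorBundle (n : ℕ) (X : Type u) [TopologicalSpace X] [ChartedSpace ℂ X] where
  /-- the fibres -/
  E : X → Type u
  [addE : ∀ x, AddCommGroup (E x)]
  [moduleE : ∀ x, Module ℂ (E x)]
  [topE : ∀ x, TopologicalSpace (E x)]
  [topTotal : TopologicalSpace (Bundle.TotalSpace (Fin n → ℂ) E)]
  [fiberBundle : FiberBundle (Fin n → ℂ) E]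
  [vectorBundle : VectorBundle ℂ (Fin n → ℂ) E]
  [holomorphic : ContMDiffVectorBundle ω (Fin n → ℂ) E 𝓘(ℂ, ℂ)]

namespace HolVectorBundle

attribute [instance] addE moduleE topE topTotal fiberBundle vectorBundle holomorphic

variable {n : ℕ} {X : Type u} [TopologicalSpace X] [ChartedSpace ℂ X]

/-- The total space of a vector bundle. -/
abbrev Total (A : HolVectorBundle n X) : Type u := Bundle.TotalSpace (Fin n → ℂ) A.E

/-- The frames at `x`, i.e. the linear isomorphisms from `ℂⁿ` to the fibre at `x`: the fibre at `x`
of the bundle of frames. -/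
abbrev Frame (A : HolVectorBundle n X) (x : X) : Type u := (Fin n → ℂ) ≃ₗ[ℂ] A.E x

/-- The right action of `SL(n, ℂ)` on frames: `p · a = p ∘ a`. -/
def frameMul {A : HolVectorBundle n X} {x : X} (p : A.Frame x)
    (a : Matrix.SpecialLinearGroup (Fin n) ℂ) : A.Frame x :=
  (Matrix.SpecialLinearGroup.toLin' a).trans p

/-- A holomorphic section of the quotient of the bundle of frames of `A` by `H ⊆ SL(n, ℂ)`, i.e. a
reduction of structure group to `H`: it assigns to each `x` an `H`-orbit `p H` of frames at `x`, and
it is holomorphic in the sense that it lifts locally to a holomorphic frame. -/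
structure Reduction (A : HolVectorBundle n X)
    (H : Subgroup (Matrix.SpecialLinearGroup (Fin n) ℂ)) where
  /-- the orbit of frames at each point -/
  carrier : ∀ x, Set (A.Frame x)
  isOrbit : ∀ x, ∃ p : A.Frame x, carrier x = {q | ∃ a ∈ H, q = frameMul p a}
  exists_lift : ∀ x, ∃ U : Set X, IsOpen U ∧ x ∈ U ∧ ∃ s : ∀ y, A.Frame y,
    (∀ y ∈ U, s y ∈ carrier y) ∧
    ∀ v : Fin n → ℂ, ContMDiffOn 𝓘(ℂ, ℂ) (𝓘(ℂ, ℂ).prod 𝓘(ℂ, Fin n → ℂ)) ω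
      (fun y => (⟨y, s y v⟩ : A.Total)) U

end HolVectorBundle

/-- A `Γ`-pseudo-equivariant `G`-bundle `(E, h, f)` of rank `n` over `X`. A family of isomorphisms
`f γ` from `E` to the pullback of `E` along `γ` is a holomorphic family of linear isomorphisms from
the fibre at `x` to the fibre at `x · γ`. -/
structure PseudoEquivariantBundle
    {Γ : Type z} {G : Type w} [Group Γ] [Group G] {θ : Γ →* MulAut G} {c : TwoCocycle θ} {n : ℕ}
    (X : Type u) [TopologicalSpace X] [ChartedSpace ℂ X] [MulAction Γᵐᵒᵖ X]
    (ι : TwistedProduct θ c →* Matrix.SpecialLinearGroup (Fin n) ℂ)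
    extends HolVectorBundle n X where
  /-- the reduction of structure group to `ι(G)` -/
  h : toHolVectorBundle.Reduction (ι.comp (TwistedProduct.inl θ c)).range
  /-- the pseudo-equivariant structure -/
  f : ∀ (γ : Γ) (x : X), E x ≃ₗ[ℂ] E (x <• γ)
  contMDiff_f : ∀ γ : Γ, ContMDiff (𝓘(ℂ, ℂ).prod 𝓘(ℂ, Fin n → ℂ)) (𝓘(ℂ, ℂ).prod 𝓘(ℂ, Fin n → ℂ)) ω
    (fun e : toHolVectorBundle.Total => (⟨e.proj <• γ, f γ e.proj e.2⟩ : toHolVectorBundle.Total))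
  /-- `f_1 = id`, as an equality in the total space of `E` -/
  f_one : ∀ x (e : E x), (⟨x <• (1 : Γ), f 1 x e⟩ : toHolVectorBundle.Total) = ⟨x, e⟩
  /-- `γ^* f_γ' ∘ f_γ = f_(γ γ')`, as an equality in the total space of `E` -/
  f_comp : ∀ (γ γ' : Γ) x (e : E x),
    (⟨x <• γ <• γ', f γ' (x <• γ) (f γ x e)⟩ : toHolVectorBundle.Total) =
      ⟨x <• (γ * γ'), f (γ * γ') x e⟩
  /-- `f_γ(h) = (γ^* h) (1, γ)⁻¹` -/
  f_h : ∀ (γ : Γ) x,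
    (fun p : toHolVectorBundle.Frame x => p.trans (f γ x)) '' h.carrier x =
      (fun p : toHolVectorBundle.Frame (x <• γ) =>
        HolVectorBundle.frameMul p (ι (TwistedProduct.lift θ c γ))⁻¹) '' h.carrier (x <• γ)

namespace PseudoEquivariantBundle

variable {Γ : Type z} {G : Type w} [Group Γ] [Group G] {θ : Γ →* MulAut G} {c : TwoCocycle θ}
  {n : ℕ} {X : Type u} [TopologicalSpace X] [ChartedSpace ℂ X] [MulAction Γᵐᵒᵖ X]
  {ι : TwistedProduct θ c →* Matrix.SpecialLinearGroup (Fin n) ℂ}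

/-- Isomorphisms of pseudo-equivariant bundles: isomorphisms of holomorphic vector bundles
compatible with the reductions and with the pseudo-equivariant structures. -/
@[ext]
structure Iso (A B : PseudoEquivariantBundle X ι) where
  /-- the isomorphism on each fibre -/
  toFun : ∀ x, A.E x ≃ₗ[ℂ] B.E x
  contMDiff_toFun : ContMDiff (𝓘(ℂ, ℂ).prod 𝓘(ℂ, Fin n → ℂ)) (𝓘(ℂ, ℂ).prod 𝓘(ℂ, Fin n → ℂ)) ω
    (fun e : A.Total => (⟨e.proj, toFun e.proj e.2⟩ : B.Total))
  contMDiff_symm : ContMDiff (𝓘(ℂ, ℂ).prod 𝓘(ℂ, Fin n → ℂ)) (𝓘(ℂ, ℂ).prod 𝓘(ℂ, Fin n → ℂ)) ω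
    (fun e : B.Total => (⟨e.proj, (toFun e.proj).symm e.2⟩ : A.Total))
  map_h : ∀ x, (fun p : A.Frame x => p.trans (toFun x)) '' A.h.carrier x = B.h.carrier x
  map_f : ∀ (γ : Γ) x (e : A.E x), B.f γ x (toFun x e) = toFun (x <• γ) (A.f γ x e)

/-- The category of pseudo-equivariant bundles, whose morphisms are the isomorphisms. -/
noncomputable instance : Category (PseudoEquivariantBundle X ι) where
  Hom A B := Iso A B
  id A :=
    { toFun := fun x => LinearEquiv.refl ℂ (A.E x)
      contMDiff_toFun := contMDiff_id
      contMDiff_symm := contMDiff_id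
      map_h := fun x => Set.image_id _
      map_f := fun _ _ _ => rfl }
  comp φ ψ :=
    { toFun := fun x => (φ.toFun x).trans (ψ.toFun x)
      contMDiff_toFun := ψ.contMDiff_toFun.comp φ.contMDiff_toFun
      contMDiff_symm := φ.contMDiff_symm.comp ψ.contMDiff_symm
      map_h := fun x => by
        rw [← ψ.map_h x, ← φ.map_h x, Set.image_image]
        rfl
      map_f := fun γ x e => by
        simp [ψ.map_f, φ.map_f] }
  id_comp φ := by ext; rfl
  comp_id φ := by ext; rfl
  assoc φ ψ χ := by ext; rfl

end PseudoEquivariantBundle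

/-! A point `q` of a principal bundle `P` is the same thing as a frame of the associated vector
bundle `E = P ×_G ℂⁿ`, so `P` sits in the frame bundle of `E` as a reduction `h`; conversely, the
frames lying in a reduction form a principal `G`-bundle. Under this dictionary the two equivariant
structures determine each other by `frame (q • γ) = f_γ ∘ frame q ∘ ι(1, γ)`. The relations `(g,
1)(1, γ) = (1, γ)(θ_γ⁻¹ g, 1)` and `(1, γ)(1, γ') = (c(γ, γ'), 1)(1, γ γ')` in the twisted product
translate the axioms on one side into those on the other: the twist by `θ` and `c` is absorbed by
`ι(1, γ)`, so `f` satisfies an untwisted composition law, and the condition on `f_γ(h)` says that `q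
• γ` is again a frame in `h`.

The dictionary is carried by `FrameMap`, an equivariant holomorphic map from `P` to frames, and by
`Association`, a frame map whose image is `h` and which obeys the formula above. Between associated
pairs, a morphism `ψ` of principal bundles `Corresponds` to a morphism `φ` of vector bundles if they
agree on frames. Each determines the other (`right_unique`, `left_unique`) and each can be built
from the other (`toPseudoIso`, `toTwistedIso`). Functoriality, fullness and faithfulness are then
formal. For essential surjectivity, `E` and the image of its bundle of frames `P` are both
associated with `P`, and the identity of `P` corresponds to an isomorphism between them.

The analytic input is that `G` is embedded in the matrices: a `G`-valued map is holomorphic once its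
matrix entries are (`contMDiffWithinAt_of_comp`). Hence the element of `G` relating two holomorphic
frames is holomorphic (`of_eq_frameMul`), which makes the frames in `h` a manifold and the
constructed maps between principal bundles holomorphic. -/

set_option linter.unusedSectionVars false

/-! ### Maps into an embedded manifold. -/

/-- A map into a manifold is `C^n` as soon as its composite with a `C^n` embedding is. -/
theorem Manifold.IsSmoothEmbedding.contMDiffWithinAt_of_comp {𝕜 : Type*}
    [NontriviallyNormedField 𝕜]
    {E₁ E₂ E₃ : Type*} [NormedAddCommGroup E₁] [NormedSpace 𝕜 E₁]
    [NormedAddCommGroup E₂] [NormedSpace 𝕜 E₂] [NormedAddCommGroup E₃] [NormedSpace 𝕜 E₃]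
    {H₁ H₂ H₃ : Type*} [TopologicalSpace H₁] [TopologicalSpace H₂] [TopologicalSpace H₃]
    {I₁ : ModelWithCorners 𝕜 E₁ H₁} {I₂ : ModelWithCorners 𝕜 E₂ H₂} {I₃ : ModelWithCorners 𝕜 E₃ H₃}
    {M₁ M₂ M₃ : Type*} [TopologicalSpace M₁] [ChartedSpace H₁ M₁]
    [TopologicalSpace M₂] [ChartedSpace H₂ M₂] [TopologicalSpace M₃] [ChartedSpace H₃ M₃]
    {n : ℕ∞ω} [IsManifold I₂ n M₂] [IsManifold I₃ n M₃] {f : M₂ → M₃} {g : M₁ → M₂} {s : Set M₁}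
    {x : M₁} (hf : IsSmoothEmbedding I₂ I₃ n f)
    (h : ContMDiffWithinAt I₁ I₃ n (fun y => f (g y)) s x) :
    ContMDiffWithinAt I₁ I₂ n g s x := by
  have hgc : ContinuousWithinAt g s x :=
    hf.isEmbedding.isInducing.continuousWithinAt_iff.2 h.continuousWithinAt
  obtain ⟨F, _, _, hF⟩ := hf.isImmersion
  have hi := hF (g x)
  set φ := hi.domChart
  set ψ := hi.codChart
  have hφ : φ ∈ IsManifold.maximalAtlas I₂ n M₂ := hi.domChart_mem_maximalAtlas
  have hψ : ψ ∈ IsManifold.maximalAtlas I₃ n M₃ := hi.codChart_mem_maximalAtlas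
  -- In the charts of the immersion `f` is `u ↦ equiv (u, 0)`, so the first component of
  -- `equiv.symm` recovers the chart expression of `g` from that of `f ∘ g`.
  have h1 : ContMDiffWithinAt I₁ 𝓘(𝕜, E₃) n (fun y => ψ.extend I₃ (f (g y))) s x :=
    (ψ.contMDiffAt_extend hψ hi.mem_codChart_source).comp_contMDiffWithinAt x h
  have h2 : ContMDiffWithinAt I₁ 𝓘(𝕜, E₂) n
      (fun y => (hi.equiv.symm (ψ.extend I₃ (f (g y)))).1) s x :=
    ((ContinuousLinearMap.fst 𝕜 E₂ F).contDiff.contMDiff.comp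
      hi.equiv.symm.contDiff.contMDiff).contMDiffAt.comp_contMDiffWithinAt x h1
  have hev : ∀ᶠ y in nhdsWithin x s, g y ∈ φ.source :=
    hgc (φ.open_source.mem_nhds hi.mem_domChart_source)
  have key : ∀ y, g y ∈ φ.source →
      (hi.equiv.symm (ψ.extend I₃ (f (g y)))).1 = φ.extend I₂ (g y) := by
    intro y hy
    have hy' : g y ∈ (φ.extend I₂).source := by rwa [φ.extend_source]
    have := hi.writtenInCharts ((φ.extend I₂).map_source hy')
    simp only [Function.comp_apply] at this
    rw [(φ.extend I₂).left_inv hy'] at this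
    rw [this, ContinuousLinearEquiv.symm_apply_apply]
  have h3 : ContMDiffWithinAt I₁ 𝓘(𝕜, E₂) n (fun y => φ.extend I₂ (g y)) s x :=
    h2.congr_of_eventuallyEq (hev.mono fun y hy => (key y hy).symm)
      (key x hi.mem_domChart_source).symm
  have h4 := contMDiffOn_extend_symm hφ (φ.extend I₂ (g x))
    ⟨φ (g x), φ.map_source hi.mem_domChart_source, rfl⟩
  have h5 := (h4.comp x (h3.mono Set.inter_subset_left) (s := s ∩ g ⁻¹' φ.source) (by
    rintro y ⟨-, hy⟩
    exact ⟨φ (g y), φ.map_source hy, rfl⟩)).mono_of_mem_nhdsWithin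
      (Filter.inter_mem self_mem_nhdsWithin hev)
  refine h5.congr_of_eventuallyEq (hev.mono fun y hy => ?_) ?_
  · exact ((φ.extend I₂).left_inv (by rwa [φ.extend_source])).symm
  · exact ((φ.extend I₂).left_inv (by rw [φ.extend_source]; exact hi.mem_domChart_source)).symm

/-! ### Manifold structures from charts with values in a manifold. -/

section ChartedOverManifold

variable {𝕜 : Type*} [NontriviallyNormedField 𝕜] {E : Type*} [NormedAddCommGroup E]
  [NormedSpace 𝕜 E] {H : Type*} [TopologicalSpace H] {I : ModelWithCorners 𝕜 E H} {n : ℕ∞ω}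
  {M P : Type*} [TopologicalSpace M] [ChartedSpace H M] [IsManifold I n M]
  [TopologicalSpace P] [ChartedSpace M P]

/-- A space with charts in a manifold `M` and `C^n` coordinate changes is a `C^n` manifold. -/
theorem isManifold_comp_of_contMDiffOn
    (h : ∀ e ∈ atlas M P, ∀ e' ∈ atlas M P, ContMDiffOn I I n (e.symm ≫ₕ e') (e.symm ≫ₕ e').source) :
    letI := ChartedSpace.comp H M P
    IsManifold I n P := by
  let := ChartedSpace.comp H M P
  refine isManifold_of_contDiffOn I n P ?_
  rintro _ _ ⟨e, he, φ, hφ, rfl⟩ ⟨e', he', φ', hφ', rfl⟩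
  have hφm := IsManifold.subset_maximalAtlas (I := I) (n := n) hφ
  have hφm' := IsManifold.subset_maximalAtlas (I := I) (n := n) hφ'
  have h1 : ContMDiffOn I I n (φ' ∘ (e.symm ≫ₕ e') ∘ φ.symm)
      (((e ≫ₕ φ).symm) ≫ₕ (e' ≫ₕ φ')).source := by
    refine (contMDiffOn_of_mem_maximalAtlas hφm').comp ((h e he e' he').comp
      ((contMDiffOn_symm_of_mem_maximalAtlas hφm).mono ?_) ?_) ?_
    · intro y hy
      simp only [mfld_simps] at hy
      exact hy.1.1
    · intro y hy
      simp only [mfld_simps] at hy ⊢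
      exact ⟨hy.1.2, hy.2.1⟩
    · intro y hy
      simp only [mfld_simps] at hy ⊢
      exact hy.2.2
  rw [contMDiffOn_iff] at h1
  -- The criterion in `h1` is indexed by two points of `H`, whose charts are all the identity, so
  -- any point serves; without points there is nothing to prove.
  rcases isEmpty_or_nonempty H with hH | ⟨⟨y⟩⟩
  · intro z hz
    exact hH.elim (I.symm z)
  · refine (h1.2 y y).mono ?_ |>.congr ?_
    · intro z hz
      simp only [mfld_simps] at hz ⊢
      tauto
    · intro z hz
      simp [mfld_simps, chartAt_self_eq]

/-- Up to a chart of the composite structure and a chart of `M`, the `M`-valued chart `e` is a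
coordinate change, which is `C^n` by hypothesis. This is what later makes the local trivializations
biholomorphic. -/
theorem contMDiffOn_of_mem_atlas_comp
    (h : ∀ e ∈ atlas M P, ∀ e' ∈ atlas M P, ContMDiffOn I I n (e.symm ≫ₕ e') (e.symm ≫ₕ e').source)
    {e : OpenPartialHomeomorph P M} (he : e ∈ atlas M P) :
    letI := ChartedSpace.comp H M P
    ContMDiffOn I I n e e.source ∧ ContMDiffOn I I n e.symm e.target := by
  let := ChartedSpace.comp H M P
  have : IsManifold I n P := isManifold_comp_of_contMDiffOn h
  have hmem : ∀ (e' : OpenPartialHomeomorph P M) (_ : e' ∈ atlas M P) (m : M),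
      e' ≫ₕ chartAt H m ∈ IsManifold.maximalAtlas I n P := fun e' he' m =>
    IsManifold.subset_maximalAtlas ⟨e', he', chartAt H m, chart_mem_atlas H m, rfl⟩
  constructor
  · intro p hp
    set e' := chartAt M p
    set φ := chartAt H (e' p)
    have he' : e' ∈ atlas M P := chart_mem_atlas M p
    have hps : p ∈ (e' ≫ₕ φ).source := by
      simp [mfld_simps, e', φ]
    have hev : ((e' ≫ₕ φ).source ∩ e.source) ∈ nhds p :=
      ((e' ≫ₕ φ).open_source.inter e.open_source).mem_nhds ⟨hps, hp⟩
    have h1 : ContMDiffOn I I n ((e'.symm ≫ₕ e) ∘ φ.symm ∘ (e' ≫ₕ φ))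
        ((e' ≫ₕ φ).source ∩ e.source) := by
      refine (h e' he' e he).comp ((contMDiffOn_symm_of_mem_maximalAtlas
        (IsManifold.chart_mem_maximalAtlas _)).comp ((contMDiffOn_of_mem_maximalAtlas
          (hmem e' he' _)).mono Set.inter_subset_left) ?_) ?_
      · rintro y ⟨hy, -⟩
        simp only [mfld_simps] at hy
        simpa [mfld_simps, φ] using φ.map_source hy.2
      · rintro y ⟨hy, hy'⟩
        simp only [mfld_simps] at hy hy' ⊢
        simp [φ.left_inv hy.2, e'.map_source hy.1, e'.left_inv hy.1, hy']
    refine ((h1.contMDiffAt hev).congr_of_eventuallyEq ?_).contMDiffWithinAt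
    filter_upwards [hev] with y hy
    have hy1 := hy.1
    simp only [mfld_simps] at hy1
    simp [φ.left_inv hy1.2, e'.left_inv hy1.1]
  · intro m hm
    set φ := chartAt H m
    have hev : (φ.source ∩ e.target) ∈ nhds m :=
      (φ.open_source.inter e.open_target).mem_nhds ⟨mem_chart_source H m, hm⟩
    have h1 : ContMDiffOn I I n ((e ≫ₕ φ).symm ∘ φ) (φ.source ∩ e.target) := by
      refine (contMDiffOn_symm_of_mem_maximalAtlas (hmem e he m)).comp
        ((contMDiffOn_of_mem_maximalAtlas (IsManifold.chart_mem_maximalAtlas _)).mono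
          Set.inter_subset_left) ?_
      rintro y ⟨hy, hy'⟩
      simp only [mfld_simps]
      refine ⟨φ.map_source hy, ?_⟩
      change φ.symm (φ y) ∈ e.target
      rwa [φ.left_inv hy]
    refine ((h1.contMDiffAt hev).congr_of_eventuallyEq ?_).contMDiffWithinAt
    filter_upwards [hev] with y hy
    simp [φ.left_inv hy.1]

end ChartedOverManifold

/-! ### Holomorphic families of frames. -/

namespace HolVectorBundle

variable {n : ℕ} {X : Type u} [TopologicalSpace X] [ChartedSpace ℂ X]
  {EM : Type*} [NormedAddCommGroup EM] [NormedSpace ℂ EM] {HM : Type*} [TopologicalSpace HM]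
  {IM : ModelWithCorners ℂ EM HM} {M : Type*} [TopologicalSpace M] [ChartedSpace HM M]

/-- The frame `p`, read in the preferred trivialization at `x₀`. -/
noncomputable def frameCoord (A : HolVectorBundle n X) (x₀ : X) {x : X} (p : A.Frame x) :
    (Fin n → ℂ) →L[ℂ] (Fin n → ℂ) :=
  LinearMap.toContinuousLinearMap
    (((trivializationAt (Fin n → ℂ) A.E x₀).linearMapAt ℂ x) ∘ₗ (p : (Fin n → ℂ) →ₗ[ℂ] A.E x))

theorem frameCoord_apply (A : HolVectorBundle n X) {x₀ x : X}
    (hx : x ∈ (trivializationAt (Fin n → ℂ) A.E x₀).baseSet) (p : A.Frame x) (v : Fin n → ℂ) :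
    A.frameCoord x₀ p v = ((trivializationAt (Fin n → ℂ) A.E x₀) ⟨x, p v⟩).2 := by
  simp [frameCoord, Bundle.Trivialization.coe_linearMapAt_of_mem _ hx]

theorem isInvertible_frameCoord (A : HolVectorBundle n X) {x₀ x : X}
    (hx : x ∈ (trivializationAt (Fin n → ℂ) A.E x₀).baseSet) (p : A.Frame x) :
    (A.frameCoord x₀ p).IsInvertible := by
  refine ⟨(p.trans ((trivializationAt (Fin n → ℂ) A.E x₀).linearEquivAt ℂ x
    hx)).toContinuousLinearEquiv, ?_⟩
  ext v
  simp [A.frameCoord_apply hx]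

/-- A family of frames along a map `b : M → X` is holomorphic within `S` at `m`. -/
def FrameContMDiffWithinAt {A : HolVectorBundle n X} (IM : ModelWithCorners ℂ EM HM) {b : M → X}
    (s : ∀ m, A.Frame (b m)) (S : Set M) (m : M) : Prop :=
  ∀ v : Fin n → ℂ, ContMDiffWithinAt IM (𝓘(ℂ, ℂ).prod 𝓘(ℂ, Fin n → ℂ)) ω
    (fun m => (⟨b m, s m v⟩ : A.Total)) S m

variable {A : HolVectorBundle n X} {b : M → X} {s : ∀ m, A.Frame (b m)} {S : Set M} {m : M}

theorem FrameContMDiffWithinAt.base (hs : FrameContMDiffWithinAt IM s S m) :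
    ContMDiffWithinAt IM 𝓘(ℂ, ℂ) ω b S m :=
  (Bundle.contMDiffWithinAt_totalSpace.1 (hs 0)).1

theorem eventually_mem_baseSet (hb : ContinuousWithinAt b S m) :
    ∀ᶠ y in nhdsWithin m S, b y ∈ (trivializationAt (Fin n → ℂ) A.E (b m)).baseSet :=
  hb ((trivializationAt (Fin n → ℂ) A.E (b m)).open_baseSet.mem_nhds
    (FiberBundle.mem_baseSet_trivializationAt' (b m)))

theorem FrameContMDiffWithinAt.frameCoord (hs : FrameContMDiffWithinAt IM s S m) :
    ContMDiffWithinAt IM 𝓘(ℂ, (Fin n → ℂ) →L[ℂ] (Fin n → ℂ)) ω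
      (fun y => A.frameCoord (b m) (s y)) S m := by
  -- An operator on `ℂⁿ` is assembled linearly from its columns, so holomorphy on each basis vector
  -- gives holomorphy in the space of operators.
  have h1 : ∀ y, A.frameCoord (b m) (s y) = ∑ j, ContinuousLinearMap.smulRightL ℂ _ _
      (ContinuousLinearMap.proj (R := ℂ) (φ := fun _ : Fin n => ℂ) j)
      (A.frameCoord (b m) (s y) (Pi.single j 1)) := by
    intro y
    refine ContinuousLinearMap.coe_injective (LinearMap.pi_ext' fun j => ?_)
    ext
    simp [Pi.single_apply, ite_apply]
  rw [funext h1]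
  refine ContMDiffWithinAt.sum fun j _ => ?_
  refine (ContinuousLinearMap.contDiff _).contMDiff.contMDiffAt.comp_contMDiffWithinAt m ?_
  have hev := eventually_mem_baseSet (A := A) hs.base.continuousWithinAt
  refine (Bundle.contMDiffWithinAt_totalSpace.1 (hs (Pi.single j 1))).2.congr_of_eventuallyEq
    (hev.mono fun y hy => A.frameCoord_apply hy _ _) ?_
  exact A.frameCoord_apply (FiberBundle.mem_baseSet_trivializationAt' (b m)) _ _

theorem FrameContMDiffWithinAt.apply (hs : FrameContMDiffWithinAt IM s S m)
    {c : M → Fin n → ℂ} (hc : ContMDiffWithinAt IM 𝓘(ℂ, Fin n → ℂ) ω c S m) :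
    ContMDiffWithinAt IM (𝓘(ℂ, ℂ).prod 𝓘(ℂ, Fin n → ℂ)) ω
      (fun m => (⟨b m, s m (c m)⟩ : A.Total)) S m := by
  refine Bundle.contMDiffWithinAt_totalSpace.2 ⟨hs.base, ?_⟩
  have hev := eventually_mem_baseSet (A := A) hs.base.continuousWithinAt
  exact (hs.frameCoord.clm_apply hc).congr_of_eventuallyEq
    (hev.mono fun y hy => (A.frameCoord_apply hy _ _).symm)
    (A.frameCoord_apply (FiberBundle.mem_baseSet_trivializationAt' (b m)) _ _).symm

/-- In a trivialization a frame is an invertible operator, and inversion of operators is analytic.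
Thus coordinates of a holomorphic vector in a holomorphic moving frame are holomorphic. -/
theorem FrameContMDiffWithinAt.symm_apply (hs : FrameContMDiffWithinAt IM s S m)
    {c : ∀ m, A.E (b m)} (hc : ContMDiffWithinAt IM (𝓘(ℂ, ℂ).prod 𝓘(ℂ, Fin n → ℂ)) ω
      (fun m => (⟨b m, c m⟩ : A.Total)) S m) :
    ContMDiffWithinAt IM 𝓘(ℂ, Fin n → ℂ) ω (fun y => (s y).symm (c y)) S m := by
  have hev := eventually_mem_baseSet (A := A) hs.base.continuousWithinAt
  have hm := FiberBundle.mem_baseSet_trivializationAt' (F := Fin n → ℂ) (E := A.E) (b m)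
  have h1 : ContMDiffWithinAt IM 𝓘(ℂ, (Fin n → ℂ) →L[ℂ] (Fin n → ℂ)) ω
      (fun y => (A.frameCoord (b m) (s y)).inverse) S m :=
    ContDiffAt.comp_contMDiffWithinAt (n := ω) (g := ContinuousLinearMap.inverse)
      (A.isInvertible_frameCoord hm (s m)).contDiffAt_map_inverse hs.frameCoord
  have h2 := h1.clm_apply (Bundle.contMDiffWithinAt_totalSpace.1 hc).2
  have key : ∀ y, b y ∈ (trivializationAt (Fin n → ℂ) A.E (b m)).baseSet →
      (s y).symm (c y) = (A.frameCoord (b m) (s y)).inverse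
        ((trivializationAt (Fin n → ℂ) A.E (b m)) ⟨b y, c y⟩).2 := by
    intro y hy
    obtain ⟨f, hf⟩ := A.isInvertible_frameCoord hy (s y)
    rw [← hf, ContinuousLinearMap.inverse_equiv]
    symm
    rw [ContinuousLinearEquiv.coe_coe, ContinuousLinearEquiv.symm_apply_eq,
      ← ContinuousLinearEquiv.coe_coe, hf, A.frameCoord_apply hy, LinearEquiv.apply_symm_apply]
  exact h2.congr_of_eventuallyEq (hev.mono key) (key m hm)

end HolVectorBundle

/-! ### The right action of matrices on frames. -/

namespace HolVectorBundle

variable {n : ℕ} {X : Type u} [TopologicalSpace X] [ChartedSpace ℂ X] {A : HolVectorBundle n X}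

theorem frameMul_apply {x : X} (p : A.Frame x) (a : Matrix.SpecialLinearGroup (Fin n) ℂ)
    (v : Fin n → ℂ) : frameMul p a v = p (a.1.mulVec v) := rfl

theorem frameMul_one {x : X} (p : A.Frame x) : frameMul p 1 = p := by
  ext v
  simp [frameMul_apply]

theorem frameMul_mul {x : X} (p : A.Frame x) (a b : Matrix.SpecialLinearGroup (Fin n) ℂ) :
    frameMul p (a * b) = frameMul (frameMul p a) b := by
  ext v
  simp [frameMul_apply]

theorem frameMul_injective {x : X} (p : A.Frame x) :
    Function.Injective (frameMul p) := by
  intro a b h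
  ext i j
  have h1 : a.1.mulVec (Pi.single j 1) = b.1.mulVec (Pi.single j 1) :=
    p.injective (LinearEquiv.congr_fun h (Pi.single j 1))
  simpa using congrFun h1 i

section Holomorphic

variable {EM : Type*} [NormedAddCommGroup EM] [NormedSpace ℂ EM] {HM : Type*} [TopologicalSpace HM]
  {IM : ModelWithCorners ℂ EM HM} {M : Type*} [TopologicalSpace M] [ChartedSpace HM M]
  {b : M → X} {s : ∀ m, A.Frame (b m)} {S : Set M} {m : M}
  {V : Type v} [NormedAddCommGroup V] [NormedSpace ℂ V]
  {G : Type w} [Group G] [TopologicalSpace G] [ChartedSpace V G] [LieGroup 𝓘(ℂ, V) ω G]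
  {ρ : G →* Matrix.SpecialLinearGroup (Fin n) ℂ}

theorem FrameContMDiffWithinAt.comp {s : ∀ y, A.Frame y} {U : Set X}
    (hs : FrameContMDiffWithinAt (b := fun y => y) 𝓘(ℂ, ℂ) s U (b m)) (hU : U ∈ nhds (b m))
    (hb : ContMDiffWithinAt IM 𝓘(ℂ, ℂ) ω b S m) :
    FrameContMDiffWithinAt IM (fun m => s (b m)) S m := fun v =>
  ((hs v).contMDiffAt hU).comp_contMDiffWithinAt m hb

theorem contMDiffWithinAt_mulVec (hρ : Manifold.IsSmoothEmbedding 𝓘(ℂ, V)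
      𝓘(ℂ, Fin n → Fin n → ℂ) ω (fun (g : G) (i j : Fin n) => (ρ g).1 i j))
    {g : M → G} (hg : ContMDiffWithinAt IM 𝓘(ℂ, V) ω g S m) (c : Fin n → ℂ) :
    ContMDiffWithinAt IM 𝓘(ℂ, Fin n → ℂ) ω (fun m => (ρ (g m)).1.mulVec c) S m := by
  have h1 : ContMDiffWithinAt IM 𝓘(ℂ, Fin n → Fin n → ℂ) ω (fun m i j => (ρ (g m)).1 i j) S m :=
    hρ.contMDiff.contMDiffAt.comp_contMDiffWithinAt m hg
  refine contMDiffWithinAt_pi_space.2 fun i => ?_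
  simp only [Matrix.mulVec, dotProduct]
  exact ContMDiffWithinAt.sum fun j _ => ContMDiffWithinAt.mul
    (contMDiffWithinAt_pi_space.1 (contMDiffWithinAt_pi_space.1 h1 i) j) contMDiffWithinAt_const

theorem FrameContMDiffWithinAt.frameMul (hs : FrameContMDiffWithinAt IM s S m)
    (hρ : Manifold.IsSmoothEmbedding 𝓘(ℂ, V) 𝓘(ℂ, Fin n → Fin n → ℂ) ω
      (fun (g : G) (i j : Fin n) => (ρ g).1 i j))
    {g : M → G} (hg : ContMDiffWithinAt IM 𝓘(ℂ, V) ω g S m) :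
    FrameContMDiffWithinAt IM (fun m => HolVectorBundle.frameMul (s m) (ρ (g m))) S m := fun v =>
  hs.apply (contMDiffWithinAt_mulVec hρ hg v)

/-- The columns of `ρ (g m)` are the coordinates of the vectors of `s'` in the frame `s`, hence
holomorphic; the embedding `ρ` transfers this to `g`. -/
theorem FrameContMDiffWithinAt.of_eq_frameMul {s' : ∀ m, A.Frame (b m)}
    (hs : FrameContMDiffWithinAt IM s S m) (hs' : FrameContMDiffWithinAt IM s' S m)
    (hρ : Manifold.IsSmoothEmbedding 𝓘(ℂ, V) 𝓘(ℂ, Fin n → Fin n → ℂ) ω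
      (fun (g : G) (i j : Fin n) => (ρ g).1 i j))
    {g : M → G} (hg : ∀ m, s' m = HolVectorBundle.frameMul (s m) (ρ (g m))) :
    ContMDiffWithinAt IM 𝓘(ℂ, V) ω g S m := by
  refine hρ.contMDiffWithinAt_of_comp ?_
  have key : ∀ v, ContMDiffWithinAt IM 𝓘(ℂ, Fin n → ℂ) ω
      (fun m => (ρ (g m)).1.mulVec v) S m := fun v => by
    convert hs.symm_apply (hs' v) using 2 with y
    rw [LinearEquiv.eq_symm_apply, hg, frameMul_apply]
  refine contMDiffWithinAt_pi_space.2 fun i => contMDiffWithinAt_pi_space.2 fun j => ?_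
  simpa using contMDiffWithinAt_pi_space.1 (key (Pi.single j 1)) i

end Holomorphic

end HolVectorBundle

open HolVectorBundle

/-! ### Fibres and local sections of principal bundles. -/

namespace HolPrincipalBundle

variable {V : Type v} [NormedAddCommGroup V] [NormedSpace ℂ V]
  {G : Type w} [Group G] [TopologicalSpace G] [ChartedSpace V G]
  {X : Type u} [TopologicalSpace X] [ChartedSpace ℂ X] (P : HolPrincipalBundle V G X)
  {EM : Type*} [NormedAddCommGroup EM] [NormedSpace ℂ EM] {HM : Type*} [TopologicalSpace HM]
  {IM : ModelWithCorners ℂ EM HM} {M : Type*} [TopologicalSpace M] [ChartedSpace HM M]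

theorem exists_eq_smul {q q' : P.P} (h : P.proj q = P.proj q') : ∃ g : G, q' = q <• g := by
  obtain ⟨e, he, -, -, hsmul⟩ := P.exists_trivialization (P.proj q)
  have hq : q ∈ e.source := e.mem_source.2 he
  have hq' : q' ∈ e.source := e.mem_source.2 (h ▸ he)
  refine ⟨(e q).2⁻¹ * (e q').2, e.injOn hq' (e.mem_source.2 (by rwa [P.proj_smul])) ?_⟩
  change e q' = e (q <• _)
  rw [hsmul q hq, mul_inv_cancel_left, e.coe_fst hq, h, ← e.coe_fst hq']

theorem smul_left_cancel {q : P.P} {g g' : G} (h : q <• g = q <• g') : g = g' := by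
  obtain ⟨e, he, -, -, hsmul⟩ := P.exists_trivialization (P.proj q)
  have hq : q ∈ e.source := e.mem_source.2 he
  have h1 := congrArg (fun q => (e q).2) h
  simpa [hsmul q hq] using h1

/-- Every point of the base has a neighbourhood with a holomorphic section. -/
theorem exists_local_section (x : X) : ∃ U : Set X, IsOpen U ∧ x ∈ U ∧ ∃ σ : X → P.P,
    (∀ y, P.proj (σ y) = y) ∧
    ContMDiffOn 𝓘(ℂ, ℂ) (𝓘(ℂ, ℂ).prod 𝓘(ℂ, V)) ω σ U := by
  classical
  have hne : ∀ y, ∃ q, P.proj q = y := fun y => by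
    obtain ⟨e, he, -⟩ := P.exists_trivialization y
    exact ⟨e.toOpenPartialHomeomorph.symm (y, 1), e.proj_symm_apply' he⟩
  -- These arbitrary points extend the section to all of `X`, so that it is a total function with
  -- `proj ∘ σ = id`; holomorphy is claimed on the neighbourhood only.
  choose q₀ hq₀ using hne
  obtain ⟨e, he, -, hsymm, -⟩ := P.exists_trivialization x
  refine ⟨e.baseSet, e.open_baseSet, he, fun y => if y ∈ e.baseSet then
    e.toOpenPartialHomeomorph.symm (y, 1) else q₀ y, fun y => ?_, ?_⟩
  · dsimp only
    split_ifs with hy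
    · exact e.proj_symm_apply' hy
    · exact hq₀ y
  · have h1 : ContMDiffOn 𝓘(ℂ, ℂ) (𝓘(ℂ, ℂ).prod 𝓘(ℂ, V)) ω (fun y : X => (y, (1 : G))) e.baseSet :=
      contMDiffOn_id.prodMk contMDiffOn_const
    exact (hsymm.comp h1 fun y hy => e.mem_target.2 hy).congr fun y hy => if_pos hy

variable {P} {S : Set M} {m : M}

theorem contMDiffWithinAt_smul {q : M → P.P} {g : M → G}
    (hq : ContMDiffWithinAt IM (𝓘(ℂ, ℂ).prod 𝓘(ℂ, V)) ω q S m)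
    (hg : ContMDiffWithinAt IM 𝓘(ℂ, V) ω g S m) :
    ContMDiffWithinAt IM (𝓘(ℂ, ℂ).prod 𝓘(ℂ, V)) ω (fun m => q m <• g m) S m :=
  P.contMDiff_smul.contMDiffAt.comp_contMDiffWithinAt m (hq.prodMk hg)

/-- In a local trivialization the difference of two points is the quotient of their `G`-coordinates,
and division in `G` is holomorphic. -/
theorem contMDiffWithinAt_of_eq_smul [LieGroup 𝓘(ℂ, V) ω G] {q q' : M → P.P} {g : M → G}
    (hq : ContMDiffWithinAt IM (𝓘(ℂ, ℂ).prod 𝓘(ℂ, V)) ω q S m)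
    (hq' : ContMDiffWithinAt IM (𝓘(ℂ, ℂ).prod 𝓘(ℂ, V)) ω q' S m)
    (h : ∀ m, q' m = q m <• g m) : ContMDiffWithinAt IM 𝓘(ℂ, V) ω g S m := by
  obtain ⟨e, he, hsmooth, -, hsmul⟩ := P.exists_trivialization (P.proj (q m))
  have hm : q m ∈ e.source := e.mem_source.2 he
  have hm' : q' m ∈ e.source := e.mem_source.2 (by rwa [h, P.proj_smul])
  have h1 : ∀ {r : M → P.P}, ContMDiffWithinAt IM (𝓘(ℂ, ℂ).prod 𝓘(ℂ, V)) ω r S m →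
      r m ∈ e.source → ContMDiffWithinAt IM 𝓘(ℂ, V) ω (fun m => (e (r m)).2) S m := fun hr hmr =>
    (((hsmooth _ hmr).contMDiffAt (e.open_source.mem_nhds hmr)).comp_contMDiffWithinAt m hr).snd
  have key : ∀ y, q y ∈ e.source → g y = (e (q y)).2⁻¹ * (e (q' y)).2 := fun y hy => by
    rw [h, hsmul _ hy, inv_mul_cancel_left]
  exact ((h1 hq hm).inv.mul (h1 hq' hm')).congr_of_eventuallyEq
    (Filter.Eventually.mono (hq.continuousWithinAt (e.open_source.mem_nhds hm)) key) (key m hm)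

end HolPrincipalBundle

/-! ### Equivariant maps from a principal bundle to frames. -/

/-- A `G`-equivariant holomorphic map over `X` from a principal `G`-bundle to the bundle of frames
of a vector bundle, where `G` acts on frames through `ρ`. -/
structure FrameMap {V : Type v} [NormedAddCommGroup V] [NormedSpace ℂ V]
    {G : Type w} [Group G] [TopologicalSpace G] [ChartedSpace V G]
    {X : Type u} [TopologicalSpace X] [ChartedSpace ℂ X] {n : ℕ}
    (ρ : G →* Matrix.SpecialLinearGroup (Fin n) ℂ)
    (P : HolPrincipalBundle V G X) (A : HolVectorBundle n X) where
  /-- the frame defined by a point over `x` -/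
  frame : ∀ {x : X} (q : P.P), P.proj q = x → A.Frame x
  frame_smul : ∀ {x : X} (q : P.P) (g : G) (h : P.proj q = x),
    frame (q <• g) ((P.proj_smul q g).trans h) = frameMul (frame q h) (ρ g)
  contMDiff_frame : ∀ v : Fin n → ℂ,
    ContMDiff (𝓘(ℂ, ℂ).prod 𝓘(ℂ, V)) (𝓘(ℂ, ℂ).prod 𝓘(ℂ, Fin n → ℂ)) ω
      (fun q => (⟨P.proj q, frame q rfl v⟩ : A.Total))

namespace FrameMap

variable {V : Type v} [NormedAddCommGroup V] [NormedSpace ℂ V]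
  {G : Type w} [Group G] [TopologicalSpace G] [ChartedSpace V G]
  {X : Type u} [TopologicalSpace X] [ChartedSpace ℂ X] {n : ℕ}
  {ρ : G →* Matrix.SpecialLinearGroup (Fin n) ℂ}
  {P : HolPrincipalBundle V G X} {A : HolVectorBundle n X} (F : FrameMap ρ P A)
  {EM : Type*} [NormedAddCommGroup EM] [NormedSpace ℂ EM] {HM : Type*} [TopologicalSpace HM]
  {IM : ModelWithCorners ℂ EM HM} {M : Type*} [TopologicalSpace M] [ChartedSpace HM M]

theorem frame_injective (hρ : Function.Injective ρ) {x : X} {q q' : P.P} {h : P.proj q = x}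
    {h' : P.proj q' = x} (H : F.frame q h = F.frame q' h') : q = q' := by
  obtain ⟨g, rfl⟩ := P.exists_eq_smul (h.trans h'.symm)
  rw [F.frame_smul q g h] at H
  have : ρ g = ρ 1 := frameMul_injective (F.frame q h) (by rw [map_one, frameMul_one]; exact H.symm)
  rw [hρ this, MulOpposite.op_one, one_smul]

/-- The base point `x` is kept as a variable in `frame` to avoid casts between fibres; in the total
space it can be replaced by `P.proj q`. -/
theorem total_eq {x : X} (q : P.P) (h : P.proj q = x) (v : Fin n → ℂ) :
    (⟨x, F.frame q h v⟩ : A.Total) = ⟨P.proj q, F.frame q rfl v⟩ := by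
  subst h; rfl

theorem frameContMDiffWithinAt {S : Set M} {m : M} {q : M → P.P} {b : M → X}
    (hb : ∀ m, P.proj (q m) = b m)
    (hq : ContMDiffWithinAt IM (𝓘(ℂ, ℂ).prod 𝓘(ℂ, V)) ω q S m) :
    FrameContMDiffWithinAt IM (fun m => F.frame (q m) (hb m)) S m := fun v => by
  simp_rw [F.total_eq]
  exact (F.contMDiff_frame v).contMDiffAt.comp_contMDiffWithinAt m hq

/-- A map into the principal bundle is holomorphic if the corresponding family of frames is. -/
theorem contMDiffWithinAt_of_frame [LieGroup 𝓘(ℂ, V) ω G]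
    (hρ : Manifold.IsSmoothEmbedding 𝓘(ℂ, V) 𝓘(ℂ, Fin n → Fin n → ℂ) ω
      (fun (g : G) (i j : Fin n) => (ρ g).1 i j))
    {S : Set M} {m : M} {q : M → P.P} {b : M → X} (hb : ∀ m, P.proj (q m) = b m)
    (hq : FrameContMDiffWithinAt IM (fun m => F.frame (q m) (hb m)) S m) :
    ContMDiffWithinAt IM (𝓘(ℂ, ℂ).prod 𝓘(ℂ, V)) ω q S m := by
  -- Write `q = (σ ∘ b) · g` for a local section `σ`; comparing the frames of both sides shows that
  -- `g` is holomorphic.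
  obtain ⟨U, hU, hm, σ, hσ, hσU⟩ := P.exists_local_section (b m)
  have hσb : ContMDiffWithinAt IM (𝓘(ℂ, ℂ).prod 𝓘(ℂ, V)) ω (fun m => σ (b m)) S m :=
    ContMDiffAt.comp_contMDiffWithinAt m (hσU.contMDiffAt (hU.mem_nhds hm)) hq.base
  choose g hg using fun m => P.exists_eq_smul ((hσ (b m)).trans (hb m).symm)
  have hgs : ContMDiffWithinAt IM 𝓘(ℂ, V) ω g S m := by
    refine (F.frameContMDiffWithinAt (fun m => hσ (b m)) hσb).of_eq_frameMul hq hρ fun y => ?_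
    rw [← F.frame_smul _ _ (hσ (b y))]
    simp_rw [← hg]
  rw [funext hg]
  exact HolPrincipalBundle.contMDiffWithinAt_smul hσb hgs

end FrameMap

/-! ### The principal bundle of frames in a reduction. -/

namespace HolVectorBundle

variable {V : Type v} [NormedAddCommGroup V] [NormedSpace ℂ V]
  {G : Type w} [Group G] [TopologicalSpace G] [ChartedSpace V G] [LieGroup 𝓘(ℂ, V) ω G]
  {X : Type u} [TopologicalSpace X] [ChartedSpace ℂ X] {n : ℕ}
  {ρ : G →* Matrix.SpecialLinearGroup (Fin n) ℂ} {A : HolVectorBundle n X}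

namespace Reduction

theorem frameMul_mem (h : A.Reduction ρ.range) {x : X} {p : A.Frame x} (hp : p ∈ h.carrier x)
    (g : G) : frameMul p (ρ g) ∈ h.carrier x := by
  obtain ⟨p₀, hp₀⟩ := h.isOrbit x
  rw [hp₀] at hp ⊢
  obtain ⟨a, ha, rfl⟩ := hp
  exact ⟨a * ρ g, mul_mem ha ⟨g, rfl⟩, (frameMul_mul _ _ _).symm⟩

theorem exists_eq_frameMul (h : A.Reduction ρ.range) {x : X} {p p' : A.Frame x}
    (hp : p ∈ h.carrier x) (hp' : p' ∈ h.carrier x) : ∃ g : G, p' = frameMul p (ρ g) := by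
  obtain ⟨p₀, hp₀⟩ := h.isOrbit x
  rw [hp₀] at hp hp'
  obtain ⟨a, ha, rfl⟩ := hp
  obtain ⟨b, hb, rfl⟩ := hp'
  obtain ⟨g, hg⟩ := mul_mem (inv_mem ha) hb
  exact ⟨g, by rw [hg, ← frameMul_mul, mul_inv_cancel_left]⟩

/-- The total space of the principal bundle of the frames that belong to a reduction. -/
def Points (h : A.Reduction ρ.range)
    (_hρ : Manifold.IsSmoothEmbedding 𝓘(ℂ, V) 𝓘(ℂ, Fin n → Fin n → ℂ) ω
      (fun (g : G) (i j : Fin n) => (ρ g).1 i j)) : Type u :=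
  Σ x : X, {p : A.Frame x // p ∈ h.carrier x}

/-- A local holomorphic lift of a reduction, extended arbitrarily outside its domain. -/
structure LocalLift (h : A.Reduction ρ.range) where
  /-- the domain -/
  domain : Set X
  isOpen_domain : IsOpen domain
  /-- the frames -/
  frame : ∀ y, A.Frame y
  frame_mem : ∀ y, frame y ∈ h.carrier y
  holomorphic : ∀ y ∈ domain, FrameContMDiffWithinAt (b := fun y => y) 𝓘(ℂ, ℂ) frame domain y

theorem exists_localLift (h : A.Reduction ρ.range) (x : X) : ∃ l : h.LocalLift, x ∈ l.domain := by
  classical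
  obtain ⟨U, hU, hx, s, hs, hsU⟩ := h.exists_lift x
  have hne : ∀ y, ∃ p, p ∈ h.carrier y := fun y => by
    obtain ⟨p, hp⟩ := h.isOrbit y
    exact ⟨p, hp ▸ ⟨1, one_mem _, (frameMul_one p).symm⟩⟩
  choose p₀ hp₀ using hne
  refine ⟨⟨U, hU, fun y => if y ∈ U then s y else p₀ y, fun y => ?_, fun y hy v => ?_⟩, hx⟩
  · split_ifs with hy
    · exact hs y hy
    · exact hp₀ y
  · refine (hsU v y hy).congr (fun z hz => ?_) ?_
    · simp [hz]
    · simp [hy]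

variable {h : A.Reduction ρ.range}
    {hρ : Manifold.IsSmoothEmbedding 𝓘(ℂ, V) 𝓘(ℂ, Fin n → Fin n → ℂ) ω
      (fun (g : G) (i j : Fin n) => (ρ g).1 i j)}

theorem _root_.Manifold.IsSmoothEmbedding.injective_hom
    (hρ : Manifold.IsSmoothEmbedding 𝓘(ℂ, V) 𝓘(ℂ, Fin n → Fin n → ℂ) ω
      (fun (g : G) (i j : Fin n) => (ρ g).1 i j)) : Function.Injective ρ := fun a b hab =>
  hρ.isEmbedding.injective (by simp [hab])

namespace LocalLift

/-- The coordinate in `G` of a point with respect to a local lift. -/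
noncomputable def coord (l : h.LocalLift) (q : h.Points hρ) : G :=
  (h.exists_eq_frameMul (l.frame_mem q.1) q.2.2).choose

theorem frameMul_coord (l : h.LocalLift) (q : h.Points hρ) :
    q.2.1 = frameMul (l.frame q.1) (ρ (l.coord q)) :=
  (h.exists_eq_frameMul (l.frame_mem q.1) q.2.2).choose_spec

theorem coord_eq_iff (l : h.LocalLift) (q : h.Points hρ) (g : G) :
    l.coord q = g ↔ q.2.1 = frameMul (l.frame q.1) (ρ g) := by
  refine ⟨fun H => H ▸ l.frameMul_coord q, fun H => ?_⟩
  rw [l.frameMul_coord q] at H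
  exact hρ.injective_hom (frameMul_injective _ H)

/-- The point with given coordinates with respect to a local lift. -/
def point (hρ : Manifold.IsSmoothEmbedding 𝓘(ℂ, V) 𝓘(ℂ, Fin n → Fin n → ℂ) ω
      (fun (g : G) (i j : Fin n) => (ρ g).1 i j)) (l : h.LocalLift) (y : X × G) : h.Points hρ :=
  ⟨y.1, frameMul (l.frame y.1) (ρ y.2), h.frameMul_mem (l.frame_mem y.1) y.2⟩

/-- The local trivialization defined by a local lift. -/
noncomputable def chart (hρ : Manifold.IsSmoothEmbedding 𝓘(ℂ, V) 𝓘(ℂ, Fin n → Fin n → ℂ) ω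
      (fun (g : G) (i j : Fin n) => (ρ g).1 i j)) (l : h.LocalLift) :
    PartialEquiv (h.Points hρ) (X × G) where
  toFun q := (q.1, l.coord q)
  invFun := l.point hρ
  source := {q | q.1 ∈ l.domain}
  target := l.domain ×ˢ Set.univ
  map_source' q hq := ⟨hq, trivial⟩
  map_target' y hy := hy.1
  left_inv' q hq := by
    refine Sigma.ext rfl (heq_of_eq (Subtype.ext ?_))
    exact (l.frameMul_coord q).symm
  right_inv' y hy := by
    refine Prod.ext rfl ?_
    exact (l.coord_eq_iff _ _).2 rfl

theorem chart_trans_source (l l' : h.LocalLift) :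
    ((l.chart hρ).symm.trans (l'.chart hρ)).source = (l.domain ∩ l'.domain) ×ˢ Set.univ := by
  ext y
  exact ⟨fun H => ⟨⟨H.1.1, H.2⟩, trivial⟩, fun H => ⟨⟨H.1.1, trivial⟩, H.1.2⟩⟩

/-- A coordinate change expresses `l.frame · ρ g` in terms of `l'.frame`. Both are holomorphic
frames, so `of_eq_frameMul` applies. -/
theorem contMDiffOn_chart_trans (l l' : h.LocalLift) :
    ContMDiffOn (𝓘(ℂ, ℂ).prod 𝓘(ℂ, V)) (𝓘(ℂ, ℂ).prod 𝓘(ℂ, V)) ω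
      ((l.chart hρ).symm.trans (l'.chart hρ)) ((l.chart hρ).symm.trans (l'.chart hρ)).source := by
  rw [chart_trans_source]
  rintro y ⟨⟨hy, hy'⟩, -⟩
  refine contMDiffWithinAt_fst.prodMk ?_
  have h1 := (l.holomorphic y.1 hy).comp (b := Prod.fst) (m := y) (S := (l.domain ∩ l'.domain) ×ˢ
    (Set.univ : Set G)) (l.isOpen_domain.mem_nhds hy) (contMDiffWithinAt_fst (J := 𝓘(ℂ, V)))
  have h2 := (l'.holomorphic y.1 hy').comp (b := Prod.fst) (m := y) (S := (l.domain ∩ l'.domain) ×ˢ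
    (Set.univ : Set G)) (l'.isOpen_domain.mem_nhds hy') (contMDiffWithinAt_fst (J := 𝓘(ℂ, V)))
  refine h2.of_eq_frameMul (h1.frameMul hρ contMDiffWithinAt_snd) hρ fun z => ?_
  exact l'.frameMul_coord (l.point hρ z)

end LocalLift

/-- The local trivializations defined by the local lifts of a reduction. -/
noncomputable def chartedSpaceCore (h : A.Reduction ρ.range)
    (hρ : Manifold.IsSmoothEmbedding 𝓘(ℂ, V) 𝓘(ℂ, Fin n → Fin n → ℂ) ω
      (fun (g : G) (i j : Fin n) => (ρ g).1 i j)) : ChartedSpaceCore (X × G) (h.Points hρ) where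
  atlas := Set.range (LocalLift.chart hρ)
  chartAt q := (h.exists_localLift q.1).choose.chart hρ
  mem_chart_source q := (h.exists_localLift q.1).choose_spec
  chart_mem_atlas q := ⟨_, rfl⟩
  open_source := by
    rintro _ _ ⟨l, rfl⟩ ⟨l', rfl⟩
    rw [LocalLift.chart_trans_source]
    exact (l.isOpen_domain.inter l'.isOpen_domain).prod isOpen_univ
  continuousOn_toFun := by
    rintro _ _ ⟨l, rfl⟩ ⟨l', rfl⟩
    exact (LocalLift.contMDiffOn_chart_trans l l').continuousOn

/-- Continuity of the coordinate changes rests on `hρ`; since `Points` carries it in its type,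
instance search can recover it. -/
noncomputable instance : TopologicalSpace (h.Points hρ) := (h.chartedSpaceCore hρ).toTopologicalSpace

/-- The charts in `X × G`. -/
@[reducible]
noncomputable def chartedSpaceProd (h : A.Reduction ρ.range)
    (hρ : Manifold.IsSmoothEmbedding 𝓘(ℂ, V) 𝓘(ℂ, Fin n → Fin n → ℂ) ω
      (fun (g : G) (i j : Fin n) => (ρ g).1 i j)) : ChartedSpace (X × G) (h.Points hρ) :=
  (h.chartedSpaceCore hρ).toChartedSpace

noncomputable instance : ChartedSpace (ModelProd ℂ V) (h.Points hρ) :=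
  letI := h.chartedSpaceProd hρ
  ChartedSpace.comp (ModelProd ℂ V) (X × G) (h.Points hρ)

/-- The local trivialization defined by a local lift, as a homeomorphism. -/
noncomputable def LocalLift.homeo (hρ : Manifold.IsSmoothEmbedding 𝓘(ℂ, V)
      𝓘(ℂ, Fin n → Fin n → ℂ) ω (fun (g : G) (i j : Fin n) => (ρ g).1 i j)) (l : h.LocalLift) :
    OpenPartialHomeomorph (h.Points hρ) (X × G) :=
  (h.chartedSpaceCore hρ).openPartialHomeomorph (l.chart hρ) ⟨l, rfl⟩

theorem chartedSpaceProd_atlas {e : OpenPartialHomeomorph (h.Points hρ) (X × G)} :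
    e ∈ (h.chartedSpaceProd hρ).atlas ↔ ∃ l : h.LocalLift, e = l.homeo hρ := by
  constructor
  · intro he
    obtain ⟨_, ⟨_, rfl⟩, _, ⟨⟨l, rfl⟩, rfl⟩, rfl⟩ := he
    exact ⟨l, rfl⟩
  · rintro ⟨l, rfl⟩
    exact Set.mem_iUnion₂.2 ⟨l.chart hρ, ⟨l, rfl⟩, rfl⟩

variable [IsManifold 𝓘(ℂ, ℂ) ω X]

theorem chartedSpaceProd_compatible : ∀ e ∈ (h.chartedSpaceProd hρ).atlas,
    ∀ e' ∈ (h.chartedSpaceProd hρ).atlas,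
    ContMDiffOn (𝓘(ℂ, ℂ).prod 𝓘(ℂ, V)) (𝓘(ℂ, ℂ).prod 𝓘(ℂ, V)) ω (e.symm ≫ₕ e')
      (e.symm ≫ₕ e').source := by
  intro e he e' he'
  obtain ⟨l, rfl⟩ := chartedSpaceProd_atlas.1 he
  obtain ⟨l', rfl⟩ := chartedSpaceProd_atlas.1 he'
  exact LocalLift.contMDiffOn_chart_trans l l'

instance : IsManifold (𝓘(ℂ, ℂ).prod 𝓘(ℂ, V)) ω (h.Points hρ) :=
  letI := h.chartedSpaceProd hρ
  isManifold_comp_of_contMDiffOn chartedSpaceProd_compatible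

theorem LocalLift.contMDiffOn_homeo (l : h.LocalLift) :
    ContMDiffOn (𝓘(ℂ, ℂ).prod 𝓘(ℂ, V)) (𝓘(ℂ, ℂ).prod 𝓘(ℂ, V)) ω (l.homeo hρ) (l.homeo hρ).source ∧
    ContMDiffOn (𝓘(ℂ, ℂ).prod 𝓘(ℂ, V)) (𝓘(ℂ, ℂ).prod 𝓘(ℂ, V)) ω (l.homeo hρ).symm
      (l.homeo hρ).target :=
  letI := h.chartedSpaceProd hρ
  contMDiffOn_of_mem_atlas_comp chartedSpaceProd_compatible (chartedSpaceProd_atlas.2 ⟨l, rfl⟩)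

instance : MulAction Gᵐᵒᵖ (h.Points hρ) where
  smul g q := ⟨q.1, frameMul q.2.1 (ρ g.unop), h.frameMul_mem q.2.2 _⟩
  one_smul q := Sigma.ext rfl (heq_of_eq (Subtype.ext (by
    change frameMul q.2.1 (ρ 1) = _
    rw [map_one, frameMul_one])))
  mul_smul g g' q := Sigma.ext rfl (heq_of_eq (Subtype.ext (by
    change frameMul q.2.1 (ρ (g'.unop * g.unop)) = frameMul (frameMul _ _) _
    rw [map_mul, frameMul_mul])))

theorem LocalLift.coord_smul (l : h.LocalLift) (q : h.Points hρ) (g : G) :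
    l.coord (q <• g) = l.coord q * g := by
  rw [coord_eq_iff, map_mul, frameMul_mul]
  change frameMul q.2.1 (ρ g) = frameMul (frameMul (l.frame q.1) _) _
  rw [← l.frameMul_coord q]

/-- The trivialization over its domain defined by a local lift. -/
noncomputable def LocalLift.trivialization (hρ : Manifold.IsSmoothEmbedding 𝓘(ℂ, V)
      𝓘(ℂ, Fin n → Fin n → ℂ) ω (fun (g : G) (i j : Fin n) => (ρ g).1 i j)) (l : h.LocalLift) :
    Bundle.Trivialization G (fun q : h.Points hρ => q.1) where
  toOpenPartialHomeomorph := l.homeo hρ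
  baseSet := l.domain
  open_baseSet := l.isOpen_domain
  source_eq := rfl
  target_eq := rfl
  proj_toFun _ _ := rfl

theorem LocalLift.contMDiffAt_homeo (l : h.LocalLift) (q : h.Points hρ) (hq : q.1 ∈ l.domain) :
    ContMDiffAt (𝓘(ℂ, ℂ).prod 𝓘(ℂ, V)) (𝓘(ℂ, ℂ).prod 𝓘(ℂ, V)) ω
      (fun q : h.Points hρ => ((q.1, l.coord q) : X × G)) q :=
  l.contMDiffOn_homeo.1.contMDiffAt ((l.homeo hρ).open_source.mem_nhds hq)

/-- The principal bundle of the frames that belong to a reduction. -/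
noncomputable def principalBundle (h : A.Reduction ρ.range)
    (hρ : Manifold.IsSmoothEmbedding 𝓘(ℂ, V) 𝓘(ℂ, Fin n → Fin n → ℂ) ω
      (fun (g : G) (i j : Fin n) => (ρ g).1 i j)) : HolPrincipalBundle V G X where
  P := h.Points hρ
  proj q := q.1
  contMDiff_proj q := by
    obtain ⟨l, hl⟩ := h.exists_localLift q.1
    exact (l.contMDiffAt_homeo q hl).fst
  proj_smul _ _ := rfl
  contMDiff_smul := by
    rintro ⟨q, g⟩
    obtain ⟨l, hl⟩ := h.exists_localLift q.1
    have h1 := (l.contMDiffAt_homeo q hl).comp (q, g)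
      (contMDiffAt_fst (I := 𝓘(ℂ, ℂ).prod 𝓘(ℂ, V)) (J := 𝓘(ℂ, V)))
    -- In the trivialization of a local lift the action is right multiplication on the factor `G`.
    have h2 : ContMDiffAt ((𝓘(ℂ, ℂ).prod 𝓘(ℂ, V)).prod 𝓘(ℂ, V)) (𝓘(ℂ, ℂ).prod 𝓘(ℂ, V)) ω
        (fun r : h.Points hρ × G => ((r.1.1, l.coord r.1 * r.2) : X × G)) (q, g) :=
      h1.fst.prodMk (h1.snd.mul contMDiffAt_snd)
    have h3 := ((l.contMDiffOn_homeo (hρ := hρ)).2.contMDiffAt ((l.homeo hρ).open_target.mem_nhds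
      (x := (q.1, l.coord q * g)) ⟨hl, trivial⟩)).comp (q, g) h2
    refine h3.congr_of_eventuallyEq (Filter.Eventually.mono
      ((((l.homeo hρ).open_source.preimage continuous_fst).mem_nhds
        (x := (q, g)) hl)) fun r hr => ?_)
    change _ = (l.homeo hρ).symm (r.1.1, l.coord r.1 * r.2)
    rw [← l.coord_smul]
    exact ((l.homeo hρ).left_inv (x := r.1 <• r.2) hr).symm
  exists_trivialization x := by
    obtain ⟨l, hl⟩ := h.exists_localLift x
    refine ⟨l.trivialization hρ, hl, l.contMDiffOn_homeo.1, l.contMDiffOn_homeo.2,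
      fun q _ g => Prod.ext rfl (l.coord_smul q g)⟩

/-- The inclusion of the frames that belong to a reduction in the bundle of frames. -/
noncomputable def frameMap (h : A.Reduction ρ.range)
    (hρ : Manifold.IsSmoothEmbedding 𝓘(ℂ, V) 𝓘(ℂ, Fin n → Fin n → ℂ) ω
      (fun (g : G) (i j : Fin n) => (ρ g).1 i j)) : FrameMap ρ (h.principalBundle hρ) A where
  frame {x} q hq := (Eq.rec q.2.1 hq : A.Frame x)
  frame_smul {x} q g hq := by
    subst hq; rfl
  contMDiff_frame v q := by
    obtain ⟨l, hl⟩ := h.exists_localLift q.1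
    have h1 := l.contMDiffAt_homeo (hρ := hρ) q hl
    -- Near `q` the tautological frame is the lift times `ρ` of the `G`-coordinate, a product of
    -- holomorphic data.
    have h2 := ((l.holomorphic q.1 hl).comp (b := fun q : h.Points hρ => q.1) (S := Set.univ)
      (l.isOpen_domain.mem_nhds hl) h1.fst).frameMul hρ h1.snd v
    have key : ∀ r : h.Points hρ, (⟨r.1, r.2.1 v⟩ : A.Total) =
        ⟨r.1, frameMul (l.frame r.1) (ρ (l.coord r)) v⟩ := fun r => by rw [← l.frameMul_coord]
    exact h2.congr (fun r _ => key r) (key q)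

end Reduction

end HolVectorBundle

open HolVectorBundle

/-! ### The vector bundle associated with a principal bundle. -/

namespace HolPrincipalBundle

variable {V : Type v} [NormedAddCommGroup V] [NormedSpace ℂ V]
  {G : Type w} [Group G] [TopologicalSpace G] [ChartedSpace V G]
  {X : Type u} [TopologicalSpace X] [ChartedSpace ℂ X] {n : ℕ}

/-- The fibre of the vector bundle associated with a principal bundle and a representation. -/
def AssociatedFiber (_P : HolPrincipalBundle V G X) (_ρ : G →* Matrix.SpecialLinearGroup (Fin n) ℂ)
    (_x : X) : Type u := ULift.{u} (Fin n → ℂ)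

variable (P : HolPrincipalBundle V G X) (ρ : G →* Matrix.SpecialLinearGroup (Fin n) ℂ)

instance (x : X) : AddCommGroup (P.AssociatedFiber ρ x) :=
  inferInstanceAs (AddCommGroup (ULift.{u} (Fin n → ℂ)))

instance (x : X) : Module ℂ (P.AssociatedFiber ρ x) :=
  inferInstanceAs (Module ℂ (ULift.{u} (Fin n → ℂ)))

instance (x : X) : TopologicalSpace (P.AssociatedFiber ρ x) :=
  inferInstanceAs (TopologicalSpace (ULift.{u} (Fin n → ℂ)))

theorem exists_proj_eq (x : X) : ∃ q : P.P, P.proj q = x := by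
  obtain ⟨-, -, -, σ, hσ, -⟩ := P.exists_local_section x
  exact ⟨σ x, hσ x⟩

/-- A chosen point over `x`. -/
noncomputable def basePoint (x : X) : P.P := (P.exists_proj_eq x).choose

theorem proj_basePoint (x : X) : P.proj (P.basePoint x) = x := (P.exists_proj_eq x).choose_spec

variable {P}

/-- The element of the group that carries the chosen point over `x` to `q`. -/
noncomputable def fromBasePoint {x : X} (q : P.P) (h : P.proj q = x) : G :=
  (P.exists_eq_smul ((P.proj_basePoint x).trans h.symm)).choose

theorem basePoint_smul {x : X} (q : P.P) (h : P.proj q = x) :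
    q = P.basePoint x <• fromBasePoint q h :=
  (P.exists_eq_smul ((P.proj_basePoint x).trans h.symm)).choose_spec

theorem fromBasePoint_smul {x : X} (q : P.P) (g : G) (h : P.proj q = x) :
    fromBasePoint (q <• g) ((P.proj_smul q g).trans h) = fromBasePoint q h * g := by
  refine P.smul_left_cancel (q := P.basePoint x) ?_
  rw [← basePoint_smul, MulOpposite.op_mul, mul_smul, ← basePoint_smul]

/-- The frame of the associated bundle defined by a point of the principal bundle. -/
noncomputable def associatedFrame {x : X} (q : P.P) (h : P.proj q = x) :
    (Fin n → ℂ) ≃ₗ[ℂ] P.AssociatedFiber ρ x :=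
  (Matrix.SpecialLinearGroup.toLin' (ρ (fromBasePoint q h))).trans ULift.moduleEquiv.symm

/-- This is the relation `[q g, v] = [q, ρ(g) v]` of `P ×_G ℂⁿ`. No quotient is formed: each fibre
is a copy of `ℂⁿ`, identified through the chosen base point. -/
theorem associatedFrame_smul {x : X} (q : P.P) (g : G) (h : P.proj q = x) (v : Fin n → ℂ) :
    associatedFrame ρ (q <• g) ((P.proj_smul q g).trans h) v =
      associatedFrame ρ q h ((ρ g).1.mulVec v) := by
  simp only [associatedFrame, fromBasePoint_smul q g h, map_mul]
  rfl

variable (P)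

/-- A local holomorphic section of a principal bundle, extended arbitrarily outside its domain. -/
structure LocalSection where
  /-- the domain -/
  domain : Set X
  isOpen_domain : IsOpen domain
  /-- the section -/
  toFun : X → P.P
  proj_toFun : ∀ y, P.proj (toFun y) = y
  contMDiffOn : ContMDiffOn 𝓘(ℂ, ℂ) (𝓘(ℂ, ℂ).prod 𝓘(ℂ, V)) ω toFun domain

theorem exists_localSection (x : X) : ∃ l : P.LocalSection, x ∈ l.domain := by
  obtain ⟨U, hU, hx, σ, hσ, hσU⟩ := P.exists_local_section x
  exact ⟨⟨U, hU, σ, hσ, hσU⟩, hx⟩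

variable {P}

/-- The local trivialization of the associated bundle defined by a local section. -/
noncomputable def LocalSection.pretrivialization (l : P.LocalSection) :
    Bundle.Pretrivialization (Fin n → ℂ) (Bundle.TotalSpace.proj (F := Fin n → ℂ)
      (E := P.AssociatedFiber ρ)) where
  toFun e := (e.1, (associatedFrame ρ (l.toFun e.1) (l.proj_toFun e.1)).symm e.2)
  invFun y := ⟨y.1, associatedFrame ρ (l.toFun y.1) (l.proj_toFun y.1) y.2⟩
  source := Bundle.TotalSpace.proj ⁻¹' l.domain
  target := l.domain ×ˢ Set.univ
  map_source' e he := ⟨he, trivial⟩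
  map_target' y hy := hy.1
  left_inv' e _ := by simp
  right_inv' y _ := by simp
  open_target := l.isOpen_domain.prod isOpen_univ
  baseSet := l.domain
  open_baseSet := l.isOpen_domain
  source_eq := rfl
  target_eq := rfl
  proj_toFun _ _ := rfl

theorem LocalSection.pretrivialization_symm (l : P.LocalSection) {y : X} (hy : y ∈ l.domain)
    (v : Fin n → ℂ) : (l.pretrivialization ρ).symm y v =
      associatedFrame ρ (l.toFun y) (l.proj_toFun y) v := by
  have h := (l.pretrivialization ρ).mk_symm (b := y) hy v
  exact eq_of_heq (Bundle.TotalSpace.mk.inj h).2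

/-- The coordinate change between two local sections. -/
noncomputable def LocalSection.change (l l' : P.LocalSection) (y : X) : G :=
  (P.exists_eq_smul ((l'.proj_toFun y).trans (l.proj_toFun y).symm)).choose

theorem LocalSection.smul_change (l l' : P.LocalSection) (y : X) :
    l.toFun y = l'.toFun y <• l.change l' y :=
  (P.exists_eq_smul ((l'.proj_toFun y).trans (l.proj_toFun y).symm)).choose_spec

/-- Seen in the trivialization of a section, the frame of a point is the matrix of its
`G`-coordinate. Both the coordinate changes and the holomorphy of the frame map follow from this. -/
theorem LocalSection.symm_associatedFrame (l : P.LocalSection) {y : X} (q : P.P)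
    (hq : P.proj q = y) (g : G)
    (h : q = l.toFun y <• g) (v : Fin n → ℂ) :
    (associatedFrame ρ (l.toFun y) (l.proj_toFun y)).symm (associatedFrame ρ q hq v) =
      (ρ g).1.mulVec v := by
  subst h
  rw [LinearEquiv.symm_apply_eq, ← associatedFrame_smul]

/-- Matrices as continuous linear maps. -/
noncomputable def matrixCLM (n : ℕ) :
    (Fin n → Fin n → ℂ) →L[ℂ] ((Fin n → ℂ) →L[ℂ] (Fin n → ℂ)) :=
  LinearMap.toContinuousLinearMap
    ((LinearMap.toContinuousLinearMap (𝕜 := ℂ) (E := Fin n → ℂ) (F' := Fin n → ℂ)).toLinearMap ∘ₗ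
      (Matrix.toLin' (R := ℂ) (m := Fin n) (n := Fin n)).toLinearMap ∘ₗ
      (Matrix.ofLinearEquiv ℂ (m := Fin n) (n := Fin n) (α := ℂ)).toLinearMap)

theorem matrixCLM_apply (a : Fin n → Fin n → ℂ) (v : Fin n → ℂ) :
    matrixCLM n a v = (Matrix.of a).mulVec v := by
  simp [matrixCLM]

variable [LieGroup 𝓘(ℂ, V) ω G] {ρ}

theorem LocalSection.contMDiffOn_change (l l' : P.LocalSection) :
    ContMDiffOn 𝓘(ℂ, ℂ) 𝓘(ℂ, V) ω (l.change l') (l.domain ∩ l'.domain) := fun y hy =>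
  contMDiffWithinAt_of_eq_smul ((l'.contMDiffOn y hy.2).mono Set.inter_subset_right)
    ((l.contMDiffOn y hy.1).mono Set.inter_subset_left) (l.smul_change l')

theorem LocalSection.contMDiffOn_matrixCLM_change
    (hρ : Manifold.IsSmoothEmbedding 𝓘(ℂ, V) 𝓘(ℂ, Fin n → Fin n → ℂ) ω
      (fun (g : G) (i j : Fin n) => (ρ g).1 i j)) (l l' : P.LocalSection) :
    ContMDiffOn 𝓘(ℂ, ℂ) 𝓘(ℂ, (Fin n → ℂ) →L[ℂ] (Fin n → ℂ)) ω
      (fun y => matrixCLM n fun i j => (ρ (l.change l' y)).1 i j) (l.domain ∩ l'.domain) :=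
  (matrixCLM n).contDiff.contMDiff.comp_contMDiffOn
    (hρ.contMDiff.comp_contMDiffOn (l.contMDiffOn_change l'))

theorem LocalSection.matrixCLM_change (l l' : P.LocalSection) {y : X}
    (hy : y ∈ l.domain ∩ l'.domain) (v : Fin n → ℂ) :
    matrixCLM n (fun i j => (ρ (l.change l' y)).1 i j) v =
      (l'.pretrivialization ρ ⟨y, (l.pretrivialization ρ).symm y v⟩).2 := by
  rw [l.pretrivialization_symm ρ hy.1, matrixCLM_apply]
  exact (l'.symm_associatedFrame ρ _ (l.proj_toFun y) _ (l.smul_change l' y) v).symm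

/-- The vector bundle associated with a principal bundle, as a prebundle. -/
noncomputable def associatedPrebundle (P : HolPrincipalBundle V G X)
    (hρ : Manifold.IsSmoothEmbedding 𝓘(ℂ, V) 𝓘(ℂ, Fin n → Fin n → ℂ) ω
      (fun (g : G) (i j : Fin n) => (ρ g).1 i j)) :
    VectorPrebundle ℂ (Fin n → ℂ) (P.AssociatedFiber ρ) where
  pretrivializationAtlas := Set.range (LocalSection.pretrivialization ρ)
  pretrivialization_linear' := by
    rintro _ ⟨l, rfl⟩
    exact ⟨fun y _ => ⟨fun _ _ => map_add _ _ _, fun _ _ => map_smul _ _ _⟩⟩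
  pretrivializationAt x := (P.exists_localSection x).choose.pretrivialization ρ
  mem_base_pretrivializationAt x := (P.exists_localSection x).choose_spec
  pretrivialization_mem_atlas x := ⟨_, rfl⟩
  exists_coordChange := by
    rintro _ ⟨l, rfl⟩ _ ⟨l', rfl⟩
    exact ⟨_, (LocalSection.contMDiffOn_matrixCLM_change hρ l l').continuousOn,
      fun y hy v => l.matrixCLM_change l' hy v⟩
  totalSpaceMk_isInducing x := by
    -- On one fibre the trivialization is a linear automorphism of `ℂⁿ` followed by `v ↦ (x, v)`.
    set l := (P.exists_localSection x).choose
    have h1 : Topology.IsInducing (ULift.down : ULift.{u} (Fin n → ℂ) → (Fin n → ℂ)) := ⟨rfl⟩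
    exact ((isEmbedding_prodMkRight x).isInducing.comp
      (((Matrix.SpecialLinearGroup.toLin' (ρ (fromBasePoint (l.toFun x)
        (l.proj_toFun x)))).symm.toContinuousLinearEquiv).toHomeomorph.isInducing)).comp h1

instance (hρ : Manifold.IsSmoothEmbedding 𝓘(ℂ, V) 𝓘(ℂ, Fin n → Fin n → ℂ) ω
      (fun (g : G) (i j : Fin n) => (ρ g).1 i j)) :
    (P.associatedPrebundle hρ).IsContMDiff 𝓘(ℂ, ℂ) ω where
  exists_contMDiffCoordChange := by
    rintro _ ⟨l, rfl⟩ _ ⟨l', rfl⟩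
    exact ⟨_, LocalSection.contMDiffOn_matrixCLM_change hρ l l',
      fun y hy v => l.matrixCLM_change l' hy v⟩

/-- The vector bundle associated with a principal bundle. -/
noncomputable def associatedBundle (P : HolPrincipalBundle V G X)
    (hρ : Manifold.IsSmoothEmbedding 𝓘(ℂ, V) 𝓘(ℂ, Fin n → Fin n → ℂ) ω
      (fun (g : G) (i j : Fin n) => (ρ g).1 i j)) : HolVectorBundle n X :=
  letI a := P.associatedPrebundle hρ
  letI := a.totalSpaceTopology
  letI := a.toFiberBundle
  haveI := a.toVectorBundle
  haveI := a.contMDiffVectorBundle (IB := 𝓘(ℂ, ℂ)) (n := ω)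
  { E := P.AssociatedFiber ρ }

/-- The frames of the associated bundle defined by the points of a principal bundle. -/
noncomputable def associatedFrameMap (P : HolPrincipalBundle V G X)
    (hρ : Manifold.IsSmoothEmbedding 𝓘(ℂ, V) 𝓘(ℂ, Fin n → Fin n → ℂ) ω
      (fun (g : G) (i j : Fin n) => (ρ g).1 i j)) : FrameMap ρ P (P.associatedBundle hρ) where
  frame q hq := associatedFrame ρ q hq
  frame_smul q g h := LinearEquiv.ext (associatedFrame_smul ρ q g h)
  contMDiff_frame v q := by
    obtain ⟨l, hl⟩ := P.exists_localSection (P.proj q)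
    let a := P.associatedPrebundle hρ
    let := a.totalSpaceTopology
    let := a.toFiberBundle
    have := a.toVectorBundle
    have := a.contMDiffVectorBundle (IB := 𝓘(ℂ, ℂ)) (n := ω)
    have hmem : l.pretrivialization ρ ∈ a.pretrivializationAtlas := ⟨l, rfl⟩
    have : MemTrivializationAtlas (a.trivializationOfMemPretrivializationAtlas hmem) :=
      ⟨⟨_, hmem, rfl⟩⟩
    refine ((a.trivializationOfMemPretrivializationAtlas hmem).contMDiffAt_iff
      (IB := 𝓘(ℂ, ℂ)) (f := fun q => ⟨P.proj q, associatedFrame ρ q rfl v⟩) hl).2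
      ⟨P.contMDiff_proj q, ?_⟩
    -- With `q = l(proj q) · g q`, the vector reads `ρ (g q) v` in the trivialization of `l`.
    choose g hg using fun q => P.exists_eq_smul (l.proj_toFun (P.proj q))
    have hσ : ContMDiffWithinAt (𝓘(ℂ, ℂ).prod 𝓘(ℂ, V)) (𝓘(ℂ, ℂ).prod 𝓘(ℂ, V)) ω
        (fun q => l.toFun (P.proj q)) Set.univ q :=
      ContMDiffAt.comp_contMDiffWithinAt q
        (l.contMDiffOn.contMDiffAt (l.isOpen_domain.mem_nhds hl)) (P.contMDiff_proj q)
    have hgs := contMDiffWithinAt_mulVec hρ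
      (contMDiffWithinAt_of_eq_smul hσ contMDiffWithinAt_id hg) v
    have key : ∀ r, ((l.pretrivialization ρ) ⟨P.proj r, associatedFrame ρ r rfl v⟩).2 =
        (ρ (g r)).1.mulVec v := fun r => l.symm_associatedFrame ρ r rfl (g r) (hg r) v
    exact hgs.congr (fun r _ => key r) (key q)

end HolPrincipalBundle

open HolVectorBundle

/-! ### Frame maps seen in the total space. -/

theorem mulVec_mulVec_coe {n : ℕ} (a b : Matrix.SpecialLinearGroup (Fin n) ℂ) (v : Fin n → ℂ) :
    a.1.mulVec (b.1.mulVec v) = (a * b).1.mulVec v := by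
  simp

namespace FrameMap

variable {V : Type v} [NormedAddCommGroup V] [NormedSpace ℂ V]
  {G : Type w} [Group G] [TopologicalSpace G] [ChartedSpace V G]
  {X : Type u} [TopologicalSpace X] [ChartedSpace ℂ X] {n : ℕ}
  {ρ : G →* Matrix.SpecialLinearGroup (Fin n) ℂ}
  {P : HolPrincipalBundle V G X} {A B : HolVectorBundle n X} (F : FrameMap ρ P A)

/-- The point of the total space with coordinates `v` in the frame defined by `q`. -/
noncomputable def total (q : P.P) (v : Fin n → ℂ) : A.Total := ⟨P.proj q, F.frame q rfl v⟩

theorem total_eq_mk {x : X} (q : P.P) (h : P.proj q = x) (v : Fin n → ℂ) :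
    F.total q v = ⟨x, F.frame q h v⟩ := (F.total_eq q h v).symm

theorem total_smul (q : P.P) (g : G) (v : Fin n → ℂ) :
    F.total (q <• g) v = F.total q ((ρ g).1.mulVec v) := by
  rw [F.total_eq_mk _ (P.proj_smul q g), F.frame_smul q g rfl]
  rfl

/-- Reduces every identity between points of `P`, notably the axioms of the twisted action, to
identities between vectors in the total space, where points over different expressions of the same
base point can be compared. -/
theorem total_injective (hρ : Function.Injective ρ) {q q' : P.P}
    (h : ∀ v, F.total q v = F.total q' v) : q = q' := by
  have h0 : P.proj q = P.proj q' := congrArg Bundle.TotalSpace.proj (h 0)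
  refine F.frame_injective hρ (h := h0) (h' := rfl) (LinearEquiv.ext fun v => ?_)
  have h1 := h v
  rw [F.total_eq_mk q h0] at h1
  exact eq_of_heq (Bundle.TotalSpace.mk.inj h1).2

theorem contMDiff_total (v : Fin n → ℂ) :
    ContMDiff (𝓘(ℂ, ℂ).prod 𝓘(ℂ, V)) (𝓘(ℂ, ℂ).prod 𝓘(ℂ, Fin n → ℂ)) ω (fun q => F.total q v) :=
  F.contMDiff_frame v

theorem exists_total_eq {x : X} (q : P.P) (h : P.proj q = x) (e : A.E x) :
    ∃ v, F.total q v = ⟨x, e⟩ :=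
  ⟨(F.frame q h).symm e, by rw [F.total_eq_mk q h, LinearEquiv.apply_symm_apply]⟩

theorem contMDiff_of_total [LieGroup 𝓘(ℂ, V) ω G]
    (hρ : Manifold.IsSmoothEmbedding 𝓘(ℂ, V) 𝓘(ℂ, Fin n → Fin n → ℂ) ω
      (fun (g : G) (i j : Fin n) => (ρ g).1 i j))
    {EM : Type*} [NormedAddCommGroup EM] [NormedSpace ℂ EM] {HM : Type*} [TopologicalSpace HM]
    {IM : ModelWithCorners ℂ EM HM} {M : Type*} [TopologicalSpace M] [ChartedSpace HM M]
    {q : M → P.P}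
    (hq : ∀ v, ContMDiff IM (𝓘(ℂ, ℂ).prod 𝓘(ℂ, Fin n → ℂ)) ω (fun m => F.total (q m) v)) :
    ContMDiff IM (𝓘(ℂ, ℂ).prod 𝓘(ℂ, V)) ω q := fun m =>
  F.contMDiffWithinAt_of_frame hρ (fun _ => rfl) fun v => hq v m

/-- A fibrewise linear map between vector bundles is holomorphic if it maps the frames defined by a
principal bundle holomorphically. -/
theorem contMDiff_of_comp_total {b : X → X} (T : ∀ x, A.E x ≃ₗ[ℂ] B.E (b x))
    (hT : ∀ v, ContMDiff (𝓘(ℂ, ℂ).prod 𝓘(ℂ, V)) (𝓘(ℂ, ℂ).prod 𝓘(ℂ, Fin n → ℂ)) ω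
      (fun q => (⟨b (F.total q v).1, T _ (F.total q v).2⟩ : B.Total))) :
    ContMDiff (𝓘(ℂ, ℂ).prod 𝓘(ℂ, Fin n → ℂ)) (𝓘(ℂ, ℂ).prod 𝓘(ℂ, Fin n → ℂ)) ω
      (fun e : A.Total => (⟨b e.1, T e.1 e.2⟩ : B.Total)) := by
  intro e₀
  obtain ⟨l, hl⟩ := P.exists_localSection e₀.1
  have hproj : ContMDiffAt (𝓘(ℂ, ℂ).prod 𝓘(ℂ, Fin n → ℂ)) 𝓘(ℂ, ℂ) ω
    (fun e : A.Total => e.1) e₀ := Bundle.contMDiffAt_proj A.E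
  have hσ : ContMDiffWithinAt (𝓘(ℂ, ℂ).prod 𝓘(ℂ, Fin n → ℂ)) (𝓘(ℂ, ℂ).prod 𝓘(ℂ, V)) ω
      (fun e : A.Total => l.toFun e.1) Set.univ e₀ :=
    ContMDiffAt.comp_contMDiffWithinAt e₀
      (l.contMDiffOn.contMDiffAt (l.isOpen_domain.mem_nhds hl)) hproj
  -- Expand `e` in the frame of a local section: its coordinates depend holomorphically on `e`, and
  -- `T` carries this frame to a holomorphic one.
  have h1 := F.frameContMDiffWithinAt (fun e : A.Total => l.proj_toFun e.1) hσ
  have h2 := h1.symm_apply (c := fun e => e.2) contMDiffWithinAt_id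
  have h3 : FrameContMDiffWithinAt (𝓘(ℂ, ℂ).prod 𝓘(ℂ, Fin n → ℂ)) (b := fun e : A.Total => b e.1)
      (fun e => (F.frame (l.toFun e.1) (l.proj_toFun e.1)).trans (T e.1)) Set.univ e₀ := fun v => by
    refine ((hT v).contMDiffAt.comp_contMDiffWithinAt e₀ hσ).congr (fun e _ => ?_) ?_
    all_goals exact (congrArg (fun e' : A.Total => (⟨b e'.1, T e'.1 e'.2⟩ : B.Total))
      (F.total_eq_mk _ (l.proj_toFun _) v)).symm
  exact contMDiffWithinAt_univ.1 (by simpa using h3.apply h2)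

/-- The reduction of structure group defined by a principal bundle. -/
noncomputable def reduction : A.Reduction ρ.range where
  carrier x := {p | ∃ (q : P.P) (h : P.proj q = x), F.frame q h = p}
  isOrbit x := by
    refine ⟨F.frame (P.basePoint x) (P.proj_basePoint x), Set.ext fun p => ⟨?_, ?_⟩⟩
    · rintro ⟨q, h, rfl⟩
      obtain ⟨g, rfl⟩ := P.exists_eq_smul ((P.proj_basePoint x).trans h.symm)
      exact ⟨ρ g, ⟨g, rfl⟩, F.frame_smul _ _ _⟩
    · rintro ⟨_, ⟨g, rfl⟩, rfl⟩
      exact ⟨_, _, F.frame_smul _ g (P.proj_basePoint x)⟩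
  exists_lift x := by
    obtain ⟨l, hl⟩ := P.exists_localSection x
    exact ⟨l.domain, l.isOpen_domain, hl, fun y => F.frame (l.toFun y) (l.proj_toFun y),
      fun y _ => ⟨_, _, rfl⟩, fun v y hy =>
        F.frameContMDiffWithinAt l.proj_toFun (l.contMDiffOn y hy) v⟩

end FrameMap

theorem HolVectorBundle.Reduction.carrier_eq_reduction_frameMap
    {V : Type v} [NormedAddCommGroup V] [NormedSpace ℂ V]
    {G : Type w} [Group G] [TopologicalSpace G] [ChartedSpace V G] [LieGroup 𝓘(ℂ, V) ω G]
    {X : Type u} [TopologicalSpace X] [ChartedSpace ℂ X] [IsManifold 𝓘(ℂ, ℂ) ω X] {n : ℕ}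
    {ρ : G →* Matrix.SpecialLinearGroup (Fin n) ℂ} {A : HolVectorBundle n X}
    (h : A.Reduction ρ.range)
    (hρ : Manifold.IsSmoothEmbedding 𝓘(ℂ, V) 𝓘(ℂ, Fin n → Fin n → ℂ) ω
      (fun (g : G) (i j : Fin n) => (ρ g).1 i j)) :
    h.carrier = (h.frameMap hρ).reduction.carrier := by
  ext x p
  constructor
  · exact fun hp => ⟨⟨x, p, hp⟩, rfl, rfl⟩
  · rintro ⟨q, rfl, rfl⟩
    exact q.2.2

/-! ### From twisted actions to pseudo-equivariant structures. -/

section Correspondence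

variable {V : Type v} [NormedAddCommGroup V] [NormedSpace ℂ V]
  {Γ : Type z} {G : Type w} [Group Γ] [Group G] [TopologicalSpace G] [ChartedSpace V G]
  {X : Type u} [TopologicalSpace X] [ChartedSpace ℂ X] [MulAction Γᵐᵒᵖ X]
  {θ : Γ →* MulAut G} {c : TwoCocycle θ} {n : ℕ}
  {ι : TwistedProduct θ c →* Matrix.SpecialLinearGroup (Fin n) ℂ}

namespace TwistedProduct

/-- The counterpart in the twisted product of the axiom `act_smul`. -/
theorem inl_mul_lift (g : G) (γ : Γ) : inl θ c g * lift θ c γ = lift θ c γ * inl θ c ((θ γ)⁻¹ g) := by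
  ext <;> simp [mul_def, inl, lift, c.one_left, c.one_right]

/-- The counterpart of `act_act`: `lift` fails to be multiplicative exactly by `c`. -/
theorem lift_mul_lift (γ γ' : Γ) :
    lift θ c γ * lift θ c γ' = inl θ c (c.toFun γ γ') * lift θ c (γ * γ') := by
  ext <;> simp [mul_def, inl, lift, c.one_left]

theorem lift_one : lift θ c 1 = 1 := rfl

end TwistedProduct

open TwistedProduct

/-- The map of total spaces defined by a pseudo-equivariant structure. -/
def PseudoEquivariantBundle.totalMap (E : PseudoEquivariantBundle X ι) (γ : Γ)
    (e : E.toHolVectorBundle.Total) : E.toHolVectorBundle.Total := ⟨e.1 <• γ, E.f γ e.1 e.2⟩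

/-- An identification of a twisted equivariant bundle with the bundle of the frames in the reduction
of a pseudo-equivariant bundle. -/
structure Association (P : TwistedEquivariantBundle V X θ c) (E : PseudoEquivariantBundle X ι)
    extends FrameMap (ι.comp (inl θ c)) P.toHolPrincipalBundle E.toHolVectorBundle where
  carrier_eq : E.h.carrier = toFrameMap.reduction.carrier
  total_act : ∀ (q : P.P) (γ : Γ) (v : Fin n → ℂ), toFrameMap.total (P.act q γ) v =
    E.totalMap γ (toFrameMap.total q ((ι (lift θ c γ)).1.mulVec v))

namespace TwistedEquivariantBundle

variable (P : TwistedEquivariantBundle V X θ c) {A : HolVectorBundle n X}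
  (F : FrameMap (ι.comp (inl θ c)) P.toHolPrincipalBundle A)

theorem proj_act_eq {x : X} {q : P.P} (h : P.proj q = x) (γ : Γ) :
    P.proj (P.act q γ) = x <• γ := by rw [P.proj_act, h]

/-- Acting by `γ⁻¹` inverts the action of `γ` up to `c(γ⁻¹, γ)`, which is divided out beforehand.
This gives the reverse inclusion in `f_h`. -/
theorem exists_act_eq (q : P.P) (γ : Γ) : ∃ r, P.act r γ = q := by
  refine ⟨P.act (q <• (c.toFun γ⁻¹ γ)⁻¹) γ⁻¹, ?_⟩
  rw [P.act_act, inv_mul_cancel, P.act_one, ← mul_smul, ← MulOpposite.op_mul, inv_mul_cancel,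
    MulOpposite.op_one, one_smul]

variable {P}

/-- The pseudo-equivariant structure, on a vector bundle framed by a twisted equivariant bundle. -/
noncomputable def pseudoMap (γ : Γ) (x : X) : A.E x ≃ₗ[ℂ] A.E (x <• γ) :=
  (F.frame (P.basePoint x) (P.proj_basePoint x)).symm.trans
    (frameMul (F.frame (P.act (P.basePoint x) γ) (P.proj_act_eq (P.proj_basePoint x) γ))
      (ι (lift θ c γ))⁻¹)

/-- The definition of `pseudoMap` does not depend on the base point: moving it by `g` multiplies one
frame by `g` and the other by `θ_γ⁻¹ g`, and conjugation by `(1, γ)` matches the two. -/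
theorem frame_trans_pseudoMap (γ : Γ) {x : X} (q : P.P) (h : P.proj q = x) :
    (F.frame q h).trans (pseudoMap F γ x) =
      frameMul (F.frame (P.act q γ) (P.proj_act_eq h γ)) (ι (lift θ c γ))⁻¹ := by
  obtain ⟨g, rfl⟩ := P.exists_eq_smul ((P.proj_basePoint x).trans h.symm)
  have h1 := F.frame_smul (P.act (P.basePoint x) γ) ((θ γ)⁻¹ g)
    (P.proj_act_eq (P.proj_basePoint x) γ)
  have h2 : F.frame (P.act (P.basePoint x <• g) γ) (P.proj_act_eq h γ) =
      frameMul (F.frame (P.act (P.basePoint x) γ) (P.proj_act_eq (P.proj_basePoint x) γ))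
        (ι (inl θ c ((θ γ)⁻¹ g))) := by
    rw [← MonoidHom.comp_apply, ← h1]
    simp_rw [P.act_smul]
  rw [h2, F.frame_smul _ g (P.proj_basePoint x), ← frameMul_mul, ← map_inv ι, ← map_mul ι]
  have h3 : inl θ c ((θ γ)⁻¹ g) * (lift θ c γ)⁻¹ = (lift θ c γ)⁻¹ * inl θ c g := by
    rw [eq_inv_mul_iff_mul_eq, ← mul_assoc, ← inl_mul_lift, mul_inv_cancel_right]
  rw [h3, map_mul, frameMul_mul, map_inv]
  ext v
  simp [pseudoMap, frameMul_apply]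

theorem pseudoMap_total (γ : Γ) (q : P.P) (v : Fin n → ℂ) :
    (⟨(F.total q v).1 <• γ, pseudoMap F γ _ (F.total q v).2⟩ : A.Total) =
      F.total (P.act q γ) ((ι (lift θ c γ))⁻¹.1.mulVec v) := by
  rw [F.total_eq_mk _ (P.proj_act_eq rfl γ)]
  exact congrArg _ (LinearEquiv.congr_fun (frame_trans_pseudoMap F γ q rfl) v)

/-- The pseudo-equivariant bundle whose bundle of frames contains a twisted equivariant bundle. -/
noncomputable def toPseudo :
    PseudoEquivariantBundle X ι where
  toHolVectorBundle := A
  h := F.reduction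
  f := pseudoMap F
  contMDiff_f γ := by
    refine F.contMDiff_of_comp_total (b := fun x => x <• γ) (pseudoMap F γ) fun v => ?_
    simp_rw [pseudoMap_total]
    exact (F.contMDiff_total _).comp (P.contMDiff_act γ)
  f_one x e := by
    obtain ⟨v, hv⟩ := F.exists_total_eq _ (P.proj_basePoint x) e
    have h := pseudoMap_total F 1 (P.basePoint x) v
    rw [hv, P.act_one, lift_one, map_one, inv_one] at h
    rw [← hv]
    simpa using h
  f_comp γ γ' x e := by
    obtain ⟨v, hv⟩ := F.exists_total_eq _ (P.proj_basePoint x) e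
    have h1 := pseudoMap_total F γ (P.basePoint x) v
    have h2 := pseudoMap_total F γ' (P.act (P.basePoint x) γ) ((ι (lift θ c γ))⁻¹.1.mulVec v)
    have h3 := pseudoMap_total F (γ * γ') (P.basePoint x) v
    rw [hv] at h1 h3
    rw [← h1, P.act_act, P.act_smul, F.total_smul] at h2
    refine h2.trans (Eq.trans ?_ h3.symm)
    congr 1
    -- What remains is an identity of matrices. The action of `γ γ'` has turned `c(γ, γ')` into its
    -- image under `θ_(γ γ')⁻¹`, which cancels the defect of `lift`.
    have h4 : lift θ c (γ * γ') * inl θ c ((θ (γ * γ'))⁻¹ (c.toFun γ γ')) =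
        lift θ c γ * lift θ c γ' := by rw [← inl_mul_lift, lift_mul_lift]
    have h5 : inl θ c ((θ (γ * γ'))⁻¹ (c.toFun γ γ')) * (lift θ c γ')⁻¹ * (lift θ c γ)⁻¹ =
        (lift θ c (γ * γ'))⁻¹ := by
      rw [mul_assoc, ← mul_inv_rev, ← h4, mul_inv_rev, mul_inv_cancel_left]
    have h6 : ι.comp (inl θ c) ((θ (γ * γ'))⁻¹ (c.toFun γ γ')) * (ι (lift θ c γ'))⁻¹ *
        (ι (lift θ c γ))⁻¹ = (ι (lift θ c (γ * γ')))⁻¹ := by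
      rw [MonoidHom.comp_apply, ← map_inv ι, ← map_inv ι, ← map_mul ι, ← map_mul ι, h5, map_inv]
    rw [mulVec_mulVec_coe, mulVec_mulVec_coe, h6]
  f_h γ x := by
    ext p
    constructor
    · rintro ⟨_, ⟨q, h, rfl⟩, rfl⟩
      exact ⟨_, ⟨P.act q γ, P.proj_act_eq h γ, rfl⟩, (frame_trans_pseudoMap F γ q h).symm⟩
    · rintro ⟨_, ⟨q, h, rfl⟩, rfl⟩
      obtain ⟨r, rfl⟩ := P.exists_act_eq q γ
      have hr : P.proj r = x := MulAction.injective (MulOpposite.op γ) ((P.proj_act r γ).symm.trans h)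
      exact ⟨_, ⟨r, hr, rfl⟩, frame_trans_pseudoMap F γ r hr⟩

/-- A twisted equivariant bundle consists of the frames in the reduction of the pseudo-equivariant
bundle that it defines. -/
noncomputable def toPseudoAssociation :
    Association P (toPseudo F) where
  toFrameMap := F
  carrier_eq := rfl
  total_act q γ v := by
    refine Eq.trans ?_ (pseudoMap_total F γ q _).symm
    rw [mulVec_mulVec_coe, inv_mul_cancel, Matrix.SpecialLinearGroup.coe_one, Matrix.one_mulVec]
    rfl

end TwistedEquivariantBundle

end Correspondence

/-! ### From pseudo-equivariant structures to twisted actions. -/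

section Equivalence

open HolVectorBundle TwistedProduct

variable {V : Type v} [NormedAddCommGroup V] [NormedSpace ℂ V]
  {Γ : Type z} {G : Type w} [Group Γ] [Group G] [TopologicalSpace G] [ChartedSpace V G]
  {X : Type u} [TopologicalSpace X] [ChartedSpace ℂ X] [MulAction Γᵐᵒᵖ X]
  {θ : Γ →* MulAut G} {c : TwoCocycle θ} {n : ℕ}
  {ι : TwistedProduct θ c →* Matrix.SpecialLinearGroup (Fin n) ℂ}

namespace PseudoEquivariantBundle

variable {E : PseudoEquivariantBundle X ι} {P : HolPrincipalBundle V G X}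
  {F : FrameMap (ι.comp (inl θ c)) P E.toHolVectorBundle}

theorem totalMap_one (e : E.toHolVectorBundle.Total) : E.totalMap 1 e = e := E.f_one e.1 e.2

theorem totalMap_totalMap (γ γ' : Γ) (e : E.toHolVectorBundle.Total) :
    E.totalMap γ' (E.totalMap γ e) = E.totalMap (γ * γ') e := E.f_comp γ γ' e.1 e.2

/-- By `f_h` the frame `f_γ ∘ frame q ∘ ι(1, γ)` lies in the reduction, so it comes from a point
`r`; this point will be `q • γ`. -/
theorem exists_total_eq_totalMap (hF : E.h.carrier = F.reduction.carrier) (q : P.P) (γ : Γ) :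
    ∃ r : P.P, P.proj r = P.proj q <• γ ∧
      ∀ v, F.total r v = E.totalMap γ (F.total q ((ι (lift θ c γ)).1.mulVec v)) := by
  have h1 : (F.frame q rfl).trans (E.f γ (P.proj q)) ∈
      (fun p : E.Frame (P.proj q <• γ) => frameMul p (ι (lift θ c γ))⁻¹) ''
        E.h.carrier (P.proj q <• γ) := by
    rw [← E.f_h]
    exact ⟨_, by rw [hF]; exact ⟨q, rfl, rfl⟩, rfl⟩
  obtain ⟨p, hp, hpq⟩ := h1
  rw [hF] at hp
  obtain ⟨r, hr, rfl⟩ := hp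
  refine ⟨r, hr, fun v => ?_⟩
  have h2 := LinearEquiv.congr_fun hpq ((ι (lift θ c γ)).1.mulVec v)
  dsimp only at h2
  rw [frameMul_apply, mulVec_mulVec_coe, inv_mul_cancel, Matrix.SpecialLinearGroup.coe_one,
    Matrix.one_mulVec] at h2
  rw [F.total_eq_mk r hr, h2]
  rfl

variable [LieGroup 𝓘(ℂ, V) ω G]
  (hι : Manifold.IsSmoothEmbedding 𝓘(ℂ, V) 𝓘(ℂ, Fin n → Fin n → ℂ) ω
      (fun (g : G) (i j : Fin n) => (ι.comp (inl θ c) g).1 i j))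

/-- The twisted equivariant structure on the bundle of the frames in the reduction of a
pseudo-equivariant bundle. -/
noncomputable def toTwisted (hF : E.h.carrier = F.reduction.carrier) :
    TwistedEquivariantBundle V X θ c where
  toHolPrincipalBundle := P
  act q γ := (exists_total_eq_totalMap hF q γ).choose
  contMDiff_act γ := by
    refine F.contMDiff_of_total hι fun v => ?_
    simp_rw [(exists_total_eq_totalMap hF _ γ).choose_spec.2]
    exact (E.contMDiff_f γ).comp (F.contMDiff_total _)
  act_one q := F.total_injective hι.injective_hom fun v => by
    rw [(exists_total_eq_totalMap hF _ _).choose_spec.2, totalMap_one, lift_one, map_one,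
      Matrix.SpecialLinearGroup.coe_one, Matrix.one_mulVec]
  act_smul q g γ := F.total_injective hι.injective_hom fun v => by
    rw [(exists_total_eq_totalMap hF _ _).choose_spec.2, F.total_smul, F.total_smul,
      (exists_total_eq_totalMap hF _ _).choose_spec.2, mulVec_mulVec_coe, mulVec_mulVec_coe,
      MonoidHom.comp_apply, MonoidHom.comp_apply, ← map_mul ι, ← map_mul ι, inl_mul_lift]
  act_act q γ γ' := F.total_injective hι.injective_hom fun v => by
    rw [(exists_total_eq_totalMap hF _ _).choose_spec.2,
      (exists_total_eq_totalMap hF _ _).choose_spec.2,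
      (exists_total_eq_totalMap hF _ _).choose_spec.2, F.total_smul, totalMap_totalMap,
      mulVec_mulVec_coe, mulVec_mulVec_coe,
      MonoidHom.comp_apply, ← map_mul ι, ← map_mul ι, lift_mul_lift]
  proj_act q γ := (exists_total_eq_totalMap hF q γ).choose_spec.1

/-- The bundle of the frames in the reduction of a pseudo-equivariant bundle is associated with
it. -/
noncomputable def toTwistedAssociation (hF : E.h.carrier = F.reduction.carrier) :
    Association (toTwisted hι hF) E where
  toFrameMap := F
  carrier_eq := hF
  total_act q γ := (exists_total_eq_totalMap hF q γ).choose_spec.2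

end PseudoEquivariantBundle

/-! ### Correspondence of morphisms. -/

namespace Association

variable {P P' P'' : TwistedEquivariantBundle V X θ c} {E E' E'' : PseudoEquivariantBundle X ι}
  (S : Association P E) (S' : Association P' E') (S'' : Association P'' E'')

/-- An isomorphism of twisted equivariant bundles and one of pseudo-equivariant bundles correspond
to each other if they agree on frames. -/
def Corresponds (ψ : P ⟶ P') (φ : E ⟶ E') : Prop :=
  ∀ q v, S'.total (ψ.toDiffeo q) v = ⟨(S.total q v).1, φ.toFun _ (S.total q v).2⟩

variable {S S' S''}

theorem corresponds_id (S : Association P E) : Corresponds S S (𝟙 P) (𝟙 E) := fun _ _ => rfl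

theorem Corresponds.comp {ψ : P ⟶ P'} {φ : E ⟶ E'} {ψ' : P' ⟶ P''} {φ' : E' ⟶ E''}
    (h : Corresponds S S' ψ φ) (h' : Corresponds S' S'' ψ' φ') :
    Corresponds S S'' (ψ ≫ ψ') (φ ≫ φ') := fun q v => by
  have h1 := h' (ψ.toDiffeo q) v
  rw [h q v] at h1
  exact h1

/-- The frame of a single point over `x` already spans the fibre at `x`, so `ψ` determines `φ`. -/
theorem Corresponds.right_unique {ψ : P ⟶ P'} {φ φ' : E ⟶ E'} (h : Corresponds S S' ψ φ)
    (h' : Corresponds S S' ψ φ') : φ = φ' := by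
  refine PseudoEquivariantBundle.Iso.ext (funext fun x => LinearEquiv.ext fun e => ?_)
  obtain ⟨v, hv⟩ := S.exists_total_eq _ (P.proj_basePoint x) e
  have h1 := (h (P.basePoint x) v).symm.trans (h' (P.basePoint x) v)
  rw [hv] at h1
  exact eq_of_heq (Bundle.TotalSpace.mk.inj h1).2

/-- A point is determined by its frame, so `φ` determines `ψ`. -/
theorem Corresponds.left_unique (hι : Function.Injective (ι.comp (inl θ c)))
    {ψ ψ' : P ⟶ P'} {φ : E ⟶ E'} (h : Corresponds S S' ψ φ)
    (h' : Corresponds S S' ψ' φ) : ψ = ψ' :=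
  TwistedEquivariantBundle.Iso.ext (Diffeomorph.ext fun q =>
    S'.total_injective hι fun v => (h q v).trans (h' q v).symm)

/-- The linear isomorphisms of fibres induced by an isomorphism of principal bundles. -/
noncomputable def fiberMap (S : Association P E) (S' : Association P' E') (ψ : P ⟶ P') (x : X) :
    E.E x ≃ₗ[ℂ] E'.E x :=
  (S.frame (P.basePoint x) (P.proj_basePoint x)).symm.trans
    (S'.frame (ψ.toDiffeo (P.basePoint x)) ((ψ.proj_map _).trans (P.proj_basePoint x)))

/-- Moving the base point by `g` multiplies source and target frames by the same matrix, so the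
choice of base point in `fiberMap` is immaterial. -/
theorem frame_trans_fiberMap (S : Association P E) (S' : Association P' E') (ψ : P ⟶ P') {x : X}
    (q : P.P) (h : P.proj q = x) :
    (S.frame q h).trans (fiberMap S S' ψ x) =
      S'.frame (ψ.toDiffeo q) ((ψ.proj_map _).trans h) := by
  obtain ⟨g, rfl⟩ := P.exists_eq_smul ((P.proj_basePoint x).trans h.symm)
  have h1 : S'.frame (ψ.toDiffeo (P.basePoint x <• g)) ((ψ.proj_map _).trans h) =
      frameMul (S'.frame (ψ.toDiffeo (P.basePoint x)) ((ψ.proj_map _).trans (P.proj_basePoint x)))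
        (ι.comp (inl θ c) g) := by
    rw [← S'.frame_smul]
    simp_rw [ψ.map_smul]
  rw [h1, S.frame_smul _ g (P.proj_basePoint x)]
  ext v
  simp [fiberMap, frameMul_apply]

theorem total_fiberMap (S : Association P E) (S' : Association P' E') (ψ : P ⟶ P')
    (q : P.P) (v : Fin n → ℂ) :
    S'.total (ψ.toDiffeo q) v = ⟨(S.total q v).1, fiberMap S S' ψ _ (S.total q v).2⟩ := by
  rw [S'.total_eq_mk _ (ψ.proj_map q)]
  exact congrArg _ (LinearEquiv.congr_fun (frame_trans_fiberMap S S' ψ q rfl) v).symm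

theorem total_fiberMap_symm (S : Association P E) (S' : Association P' E') (ψ : P ⟶ P')
    (q : P'.P) (v : Fin n → ℂ) :
    S.total (ψ.toDiffeo.symm q) v =
      ⟨(S'.total q v).1, (fiberMap S S' ψ _).symm (S'.total q v).2⟩ := by
  obtain ⟨r, rfl⟩ : ∃ r, ψ.toDiffeo r = q := ψ.toDiffeo.surjective q
  rw [total_fiberMap S S' ψ r, Diffeomorph.symm_apply_apply]
  simp

/-- The isomorphism of pseudo-equivariant bundles induced by one of twisted equivariant bundles. -/
noncomputable def toPseudoIso (S : Association P E) (S' : Association P' E') (ψ : P ⟶ P') :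
    E ⟶ E' where
  toFun := fiberMap S S' ψ
  contMDiff_toFun := by
    refine S.contMDiff_of_comp_total (b := fun x => x) (fiberMap S S' ψ) fun v => ?_
    simp_rw [← total_fiberMap]
    exact (S'.contMDiff_total v).comp ψ.toDiffeo.contMDiff
  contMDiff_symm := by
    refine S'.contMDiff_of_comp_total (b := fun x => x) (fun x => (fiberMap S S' ψ x).symm)
      fun v => ?_
    simp_rw [← total_fiberMap_symm]
    exact (S.contMDiff_total v).comp ψ.toDiffeo.symm.contMDiff
  map_h x := by
    rw [S.carrier_eq, S'.carrier_eq]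
    ext p
    constructor
    · rintro ⟨_, ⟨q, h, rfl⟩, rfl⟩
      exact ⟨_, _, (frame_trans_fiberMap S S' ψ q h).symm⟩
    · rintro ⟨q, h, rfl⟩
      obtain ⟨r, rfl⟩ := ψ.toDiffeo.surjective q
      exact ⟨_, ⟨r, (ψ.proj_map r).symm.trans h, rfl⟩, frame_trans_fiberMap S S' ψ r _⟩
  map_f γ x e := by
    obtain ⟨v, hv⟩ := S.exists_total_eq _ (P.proj_basePoint x) e
    -- Inserting `ι(1, γ)⁻¹ v` cancels the factor `ι(1, γ)` in `total_act`, leaving `f_γ` applied to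
    -- the vector with coordinates `v`.
    have h1 := S.total_act (P.basePoint x) γ ((ι (lift θ c γ))⁻¹.1.mulVec v)
    have h2 := S'.total_act (ψ.toDiffeo (P.basePoint x)) γ ((ι (lift θ c γ))⁻¹.1.mulVec v)
    have h3 := total_fiberMap S S' ψ (P.act (P.basePoint x) γ) ((ι (lift θ c γ))⁻¹.1.mulVec v)
    rw [mulVec_mulVec_coe, mul_inv_cancel, Matrix.SpecialLinearGroup.coe_one,
      Matrix.one_mulVec] at h1 h2
    rw [hv] at h1
    rw [total_fiberMap S S' ψ, hv, ← ψ.map_act, h3, h1] at h2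
    exact (eq_of_heq (Bundle.TotalSpace.mk.inj h2).2).symm

theorem corresponds_toPseudoIso (S : Association P E) (S' : Association P' E') (ψ : P ⟶ P') :
    Corresponds S S' ψ (toPseudoIso S S' ψ) := total_fiberMap S S' ψ

/-- Since `φ` preserves the reductions, the image of the frame of `q` is the frame of a point of
`P'`. -/
theorem exists_total_eq_map (S : Association P E) (S' : Association P' E') (φ : E ⟶ E') (q : P.P) :
    ∃ r : P'.P, P'.proj r = P.proj q ∧
      ∀ v, S'.total r v = ⟨(S.total q v).1, φ.toFun _ (S.total q v).2⟩ := by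
  have h1 : (S.frame q rfl).trans (φ.toFun (P.proj q)) ∈ E'.h.carrier (P.proj q) := by
    rw [← φ.map_h]
    exact ⟨_, by rw [S.carrier_eq]; exact ⟨q, rfl, rfl⟩, rfl⟩
  rw [S'.carrier_eq] at h1
  obtain ⟨r, hr, hrq⟩ := h1
  refine ⟨r, hr, fun v => ?_⟩
  rw [S'.total_eq_mk r hr, hrq]
  rfl

/-- The map of principal bundles induced by an isomorphism of pseudo-equivariant bundles. -/
noncomputable def pointMap (S : Association P E) (S' : Association P' E') (φ : E ⟶ E') (q : P.P) :
    P'.P := (exists_total_eq_map S S' φ q).choose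

theorem proj_pointMap (φ : E ⟶ E') (q : P.P) : P'.proj (pointMap S S' φ q) = P.proj q :=
  (exists_total_eq_map S S' φ q).choose_spec.1

theorem total_pointMap (φ : E ⟶ E') (q : P.P) (v : Fin n → ℂ) :
    S'.total (pointMap S S' φ q) v = ⟨(S.total q v).1, φ.toFun _ (S.total q v).2⟩ :=
  (exists_total_eq_map S S' φ q).choose_spec.2 v

/-- The inverse of an isomorphism of pseudo-equivariant bundles. -/
noncomputable def _root_.PseudoEquivariantBundle.isoSymm (φ : E ⟶ E') : E' ⟶ E where
  toFun x := (φ.toFun x).symm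
  contMDiff_toFun := φ.contMDiff_symm
  contMDiff_symm := φ.contMDiff_toFun
  map_h x := by
    rw [← φ.map_h x, Set.image_image]
    convert Set.image_id _ using 2
    ext p v
    simp
  map_f γ x e := by
    obtain ⟨e, rfl⟩ := (φ.toFun x).surjective e
    rw [φ.map_f, LinearEquiv.symm_apply_apply, LinearEquiv.symm_apply_apply]

variable [LieGroup 𝓘(ℂ, V) ω G]

theorem contMDiff_pointMap (hι : Manifold.IsSmoothEmbedding 𝓘(ℂ, V) 𝓘(ℂ, Fin n → Fin n → ℂ) ω
      (fun (g : G) (i j : Fin n) => (ι.comp (inl θ c) g).1 i j)) (φ : E ⟶ E') :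
    ContMDiff (𝓘(ℂ, ℂ).prod 𝓘(ℂ, V)) (𝓘(ℂ, ℂ).prod 𝓘(ℂ, V)) ω (pointMap S S' φ) := by
  refine S'.contMDiff_of_total hι fun v => ?_
  simp_rw [total_pointMap]
  exact φ.contMDiff_toFun.comp (S.contMDiff_total v)

/-- The isomorphism of twisted equivariant bundles induced by one of pseudo-equivariant bundles. -/
noncomputable def toTwistedIso (hι : Manifold.IsSmoothEmbedding 𝓘(ℂ, V)
      𝓘(ℂ, Fin n → Fin n → ℂ) ω (fun (g : G) (i j : Fin n) => (ι.comp (inl θ c) g).1 i j))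
    (S : Association P E) (S' : Association P' E') (φ : E ⟶ E') : P ⟶ P' where
  toDiffeo :=
    { toFun := pointMap S S' φ
      invFun := pointMap S' S (PseudoEquivariantBundle.isoSymm φ)
      left_inv := fun q => S.total_injective hι.injective_hom fun v => by
        rw [total_pointMap, total_pointMap]
        simp [PseudoEquivariantBundle.isoSymm]
      right_inv := fun q => S'.total_injective hι.injective_hom fun v => by
        rw [total_pointMap, total_pointMap]
        simp [PseudoEquivariantBundle.isoSymm]
      contMDiff_toFun := contMDiff_pointMap hι φ
      contMDiff_invFun := contMDiff_pointMap hι _ }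
  proj_map := proj_pointMap φ
  map_smul q g := S'.total_injective hι.injective_hom fun v => by
    change S'.total (pointMap S S' φ _) v = S'.total (pointMap S S' φ q <• g) v
    rw [S'.total_smul, total_pointMap, total_pointMap, S.total_smul]
  map_act q γ := S'.total_injective hι.injective_hom fun v => by
    change S'.total (pointMap S S' φ _) v = S'.total (P'.act (pointMap S S' φ q) γ) v
    rw [S'.total_act, total_pointMap, total_pointMap, S.total_act]
    exact congrArg _ (φ.map_f _ _ _).symm

end Association

end Equivalence

/-! ### The equivalence of categories. -/

theorem mainTheorem9
    -- the compact Riemann surface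
    (X : Type u) [TopologicalSpace X] [T2Space X] [CompactSpace X] [ConnectedSpace X]
    [ChartedSpace ℂ X] [IsManifold 𝓘(ℂ, ℂ) ω X]
    -- the finite group, acting on the right by holomorphic automorphisms
    (Γ : Type z) [Group Γ] [Finite Γ] [MulAction Γᵐᵒᵖ X]
    (hΓ : ∀ γ : Γ, ContMDiff 𝓘(ℂ, ℂ) 𝓘(ℂ, ℂ) ω (fun x : X => x <• γ))
    -- the connected semisimple complex Lie group
    (V : Type v) [NormedAddCommGroup V] [NormedSpace ℂ V] [FiniteDimensional ℂ V]
    (G : Type w) [Group G] [TopologicalSpace G] [ChartedSpace V G] [LieGroup 𝓘(ℂ, V) ω G]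
    [ConnectedSpace G] (hG : IsSemisimpleComplexLieGroup V G)
    -- the action by holomorphic automorphisms, the cocycle and the embedding
    (θ : Γ →* MulAut G) (hθ : ∀ γ, ContMDiff 𝓘(ℂ, V) 𝓘(ℂ, V) ω (θ γ))
    (c : TwoCocycle θ) (n : ℕ)
    (ι : TwistedProduct θ c →* Matrix.SpecialLinearGroup (Fin n) ℂ)
    (hι : IsTwistedEmbedding (V := V) ι) :
    Nonempty (TwistedEquivariantBundle V X θ c ≌ PseudoEquivariantBundle X ι) := by
  have hρ : Manifold.IsSmoothEmbedding 𝓘(ℂ, V) 𝓘(ℂ, Fin n → Fin n → ℂ) ω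
      (fun (g : G) (i j : Fin n) => (ι.comp (TwistedProduct.inl θ c) g).1 i j) := hι.isSmoothEmbedding
  let S (P : TwistedEquivariantBundle V X θ c) :=
    TwistedEquivariantBundle.toPseudoAssociation (P.associatedFrameMap hρ)
  let Φ : TwistedEquivariantBundle V X θ c ⥤ PseudoEquivariantBundle X ι :=
    { obj := fun P => TwistedEquivariantBundle.toPseudo (P.associatedFrameMap hρ)
      map := fun {P P'} ψ => Association.toPseudoIso (S P) (S P') ψ
      map_id := fun P => (Association.corresponds_toPseudoIso (S P) (S P) (𝟙 P)).right_unique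
        (Association.corresponds_id (S P))
      map_comp := fun {P P' P''} ψ ψ' =>
        (Association.corresponds_toPseudoIso (S P) (S P'') (ψ ≫ ψ')).right_unique
          ((Association.corresponds_toPseudoIso (S P) (S P') ψ).comp
            (Association.corresponds_toPseudoIso (S P') (S P'') ψ')) }
  have hcorr : ∀ {P P' : TwistedEquivariantBundle V X θ c} (φ : Φ.obj P ⟶ Φ.obj P'),
      Association.Corresponds (S P) (S P') (Association.toTwistedIso hρ (S P) (S P') φ) φ :=
    fun φ q v => Association.total_pointMap φ q v
  have : Φ.Faithful := ⟨fun {P P'} ψ ψ' h => by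
    have h1 := Association.corresponds_toPseudoIso (S P) (S P') ψ
    have h2 := Association.corresponds_toPseudoIso (S P) (S P') ψ'
    change Φ.map ψ = Φ.map ψ' at h
    refine h1.left_unique hρ.injective_hom (ψ' := ψ') ?_
    change Association.Corresponds _ _ _ (Φ.map ψ)
    rw [h]
    exact h2⟩
  -- Both `φ` and the image of `toTwistedIso φ` correspond to `toTwistedIso φ`, hence coincide.
  have : Φ.Full := ⟨fun {P P'} φ => ⟨Association.toTwistedIso hρ (S P) (S P') φ,
    (Association.corresponds_toPseudoIso (S P) (S P') _).right_unique (hcorr φ)⟩⟩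
  have : Φ.EssSurj := ⟨fun E => by
    have hF : E.h.carrier = (E.h.frameMap hρ).reduction.carrier :=
      E.h.carrier_eq_reduction_frameMap hρ
    let P := PseudoEquivariantBundle.toTwisted hρ hF
    let S' : Association P E := PseudoEquivariantBundle.toTwistedAssociation hρ hF
    -- `P` is associated both with `Φ.obj P` and with `E`. The composites of the two maps over `𝟙 P`
    -- correspond to `𝟙 P`, so they are identities.
    have h1 := Association.corresponds_toPseudoIso (S P) S' (𝟙 P)
    have h2 := Association.corresponds_toPseudoIso S' (S P) (𝟙 P)
    exact ⟨P, ⟨⟨Association.toPseudoIso (S P) S' (𝟙 P), Association.toPseudoIso S' (S P) (𝟙 P),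
      (h1.comp h2).right_unique (by rw [Category.comp_id]; exact Association.corresponds_id _),
      (h2.comp h1).right_unique (by rw [Category.comp_id]; exact Association.corresponds_id _)⟩⟩⟩⟩
  have : Φ.IsEquivalence := {}
  exact ⟨Φ.asEquivalence⟩
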